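/- **Theorem 2.** Let $n\ge 3$, $0\le e\le f$ be integers, let $\Delta>0$, and let $V$ be a set of values with at least two elements. Consider a system $\Pi=\{p_1,\dots,p_n\}$ of crash-prone processes that run a deterministic protocol and communicate via reliable links. The system is partially synchronous: in every run there is a time $\mathsf{GST}$, unknown to the processes, after which processes that have not crashed compute without delay and messages take at most $\Delta$ units of time to reach their destinations (messages sent before $\mathsf{GST}$ arrive by $\mathsf{GST}+\Delta$); the bound $\Delta$ is known to the processes. Time is measured in discrete units, and $\Delta$ is an integer. A consensus object over $V$ has the operation $\mathtt{propose}(v)$, $v\in V$, with the sequential specification that every call returns the argument of the first call. Processes need not call it at all, and a process calls it only when its previous call has returned; a process *decides* a value when a call at this process returns that value. A protocol is an *$f$-resilient consensus object* if, in every run with at most $f$ faulty (crashing) processes, the history of calls and returns is linearizable and every call made at a correct process eventually returns. The time interval $[(k-1)\Delta,k\Delta)$ is the $k$-th round. For $E\subseteq\Pi$, a run is *$E$-faulty synchronous* if the processes in $E$ crash at the beginning of the first round, all processes in $\Pi\setminus E$ are correct, all messages sent during a round are delivered precisely at the beginning of the next round, and local computations are instantaneous. A run is *two-step* for a process $p$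 if $p$ decides a value in it by time $2\Delta$. A protocol is *$e$-two-step* if for all $E\subseteq\Pi$ with $|E|=e$, every $v\in V$ and every $p\in\Pi\setminus E$: 1. there is an $E$-faulty synchronous run in which only $p$ calls $\mathtt{propose}$, once, with value $v$, and which is two-step for $p$; and 2. there is an $E$-faulty synchronous run in which the calls of $\mathtt{propose}$ are exactly one call of $\mathtt{propose}(v)$ by each process in $\Pi\setminus E$ at the beginning of the first round, and which is two-step for $p$. Then an $f$-resilient $e$-two-step consensus object is implementable (that is, some protocol is both an $f$-resilient consensus object and $e$-two-step) if and only if $n\ge\max\{2e+f-1,\,2f+1\}$. -/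

import Mathlib

universe u

/-- A deterministic message-passing protocol for the `n` processes `Fin n` over the set `V` of
proposable values.  In one step a process consumes the value it is asked to propose (if
`propose` is called at this step) and the finite list of the messages handed to it (each with
its sender, in the order of delivery); it changes its state, sends at most one message to each
process, and possibly returns a value from its pending call of `propose`. -/
structure Protocol (n : ℕ) (V : Type u) where
  /-- local states -/
  State : Type u
  /-- messages -/
  Msg : Type u
  /-- initial state of each process -/
  init : Fin n → State
  /-- new state, messages sent (by destination), value returned -/
  step : Fin n → State → Option V → List (Fin n × Msg) →
    State × (Fin n → Option Msg) × Option V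

/-- The data of an execution.  Time is `ℕ`. A message is identified by its sender, the time at
which it is sent, and its destination. -/
structure Execution {n : ℕ} {V : Type u} (P : Protocol n V) where
  /-- `p` takes no step at time `crashAt p` or later; `⊤` means that `p` is correct. -/
  crashAt : Fin n → ℕ∞
  /-- the processes that take a step at time `t` -/
  active : ℕ → Fin n → Prop
  /-- the call of `propose` made at process `p` at time `t`, if any -/
  invoke : ℕ → Fin n → Option V
  /-- the messages delivered to `q` at time `t`, in order, given by sender and sending time -/
  inbox : ℕ → Fin n → List (Fin n × ℕ)
  /-- the state of `p` just before time `t` -/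
  state : ℕ → Fin n → P.State
  /-- the message that `p` sends at time `t` to a given destination, if any -/
  sent : ℕ → Fin n → Fin n → Option P.Msg
  /-- the value that a call of `propose` returns at `p` at time `t`, if any -/
  output : ℕ → Fin n → Option V

namespace Execution

variable {n : ℕ} {V : Type u} {P : Protocol n V}

/-- The contents of the messages delivered to `q` at time `t`, with their senders. -/
def received (x : Execution P) (t : ℕ) (q : Fin n) : List (Fin n × P.Msg) :=
  (x.inbox t q).filterMap fun m => (x.sent m.2 m.1 q).map fun c => (m.1, c)

/-- The process never crashes. -/
def Correct (x : Execution P) (p : Fin n) : Prop := x.crashAt p = ⊤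

/-- Partial synchrony with known bound `Δ` from the global stabilization time `GST` on.
Every process that has not crashed takes a step at each time unit, and a message sent at time `τ`
is delivered by time `max τ GST + Δ`, unless its destination crashes by then.  The only messages
that may be lost are those sent in a step during which the sender crashes. -/
def TimelyFrom (x : Execution P) (Δ GST : ℕ) : Prop :=
  (∀ t p, GST ≤ t → (t : ℕ∞) < x.crashAt p → x.active t p) ∧
  ∀ τ s q, (x.sent τ s q).isSome → ((τ + 1 : ℕ) : ℕ∞) < x.crashAt s →
    ((max τ GST + Δ : ℕ) : ℕ∞) < x.crashAt q →
    ∃ t, t ≤ max τ GST + Δ ∧ (s, τ) ∈ x.inbox t q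

/-- `x` is a run of the protocol in the partially synchronous system with bound `Δ`. -/
structure IsRun (x : Execution P) (Δ : ℕ) : Prop where
  start : ∀ p, x.state 0 p = P.init p
  step : ∀ t p, x.active t p →
    (x.state (t + 1) p, x.sent t p, x.output t p) =
      P.step p (x.state t p) (x.invoke t p) (x.received t p)
  idle : ∀ t p, ¬ x.active t p →
    x.state (t + 1) p = x.state t p ∧ (∀ q, x.sent t p q = none) ∧ x.output t p = none ∧
      x.invoke t p = none ∧ x.inbox t p = []
  crash : ∀ t p, x.active t p → (t : ℕ∞) < x.crashAt p
  /-- only messages sent earlier are delivered -/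
  no_creation : ∀ t q s τ, (s, τ) ∈ x.inbox t q → τ < t ∧ (x.sent τ s q).isSome
  /-- no message is delivered twice -/
  nodup : ∀ t q, (x.inbox t q).Nodup
  no_duplication : ∀ t t' q m, m ∈ x.inbox t q → m ∈ x.inbox t' q → t = t'
  /-- a process calls `propose` only after its previous call has returned -/
  sequential : ∀ p i j, i < j → (x.invoke i p).isSome → (x.invoke j p).isSome →
    ∃ t, i ≤ t ∧ t < j ∧ (x.output t p).isSome
  partially_synchronous : ∃ GST, x.TimelyFrom Δ GST

/-- The call of `propose` made at `p` at time `i` returns `w` at time `t`. -/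
def Returns (x : Execution P) (p : Fin n) (i t : ℕ) (w : V) : Prop :=
  (x.invoke i p).isSome ∧ i ≤ t ∧ x.output t p = some w ∧
    ∀ s, i ≤ s → s < t → x.output s p = none

end Execution

/-- The sequential specification of a consensus object.  Its state is the value decided so far;
`propose v` yields the new state and the value returned. -/
def consensusSpec {V : Type u} : Option V → V → Option V × V
  | none, v => (some v, v)
  | some w, _ => (some w, w)

/-- A sequence of pairs (argument, returned value) of calls of `propose` is a legal sequential
history of the consensus object started in state `s`. -/
def LegalFrom {V : Type u} : Option V → List (V × V) → Prop
  | _, [] => True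
  | s, (v, r) :: l => r = (consensusSpec s v).2 ∧ LegalFrom (consensusSpec s v).1 l

/-- An operation of the object: a call `propose(arg)` made at process `proc` at time `time`. -/
structure ProposeOp (n : ℕ) (V : Type u) where
  proc : Fin n
  time : ℕ
  arg : V

namespace Execution

variable {n : ℕ} {V : Type u} {P : Protocol n V}

/-- Returns answer calls: whenever `p` returns a value, it has a pending call. -/
def WellFormed (x : Execution P) : Prop :=
  ∀ t p w, x.output t p = some w → ∃ i, x.Returns p i t w

/-- `a` returns before `b` is called. -/
def Precedes (x : Execution P) (a b : ProposeOp n V) : Prop :=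
  ∃ t w, x.Returns a.proc a.time t w ∧ t < b.time

/-- `L` is a linearization of the history of calls and returns up to time `T`: a legal
sequential history made of all the calls that return by time `T`, with the values they return,
and of some of the pending ones, completed by a return, in an order that respects real time. -/
structure IsLinearization (x : Execution P) (T : ℕ) (L : List (ProposeOp n V × V)) : Prop where
  nodup : (L.map Prod.fst).Nodup
  invoked : ∀ o ∈ L, o.1.time ≤ T ∧ x.invoke o.1.time o.1.proc = some o.1.arg
  complete : ∀ (a : ProposeOp n V) t w, x.invoke a.time a.proc = some a.arg → t ≤ T →
    x.Returns a.proc a.time t w → (a, w) ∈ L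
  real_time : L.Pairwise fun a b => ¬ x.Precedes b.1 a.1
  legal : LegalFrom none (L.map fun o => (o.1.arg, o.2))

/-- The history of `x` is linearizable: it is well-formed, and each of its finite prefixes has a
linearization. -/
def Linearizable (x : Execution P) : Prop :=
  x.WellFormed ∧ ∀ T, ∃ L, x.IsLinearization T L

/-- Every call made at a correct process returns. -/
def WaitFree (x : Execution P) : Prop :=
  ∀ p i, x.Correct p → (x.invoke i p).isSome → ∃ t w, x.Returns p i t w

/-- `x` is `E`-faulty synchronous: exactly the processes in `E` are faulty and they crash at the
beginning; the others take a step at each time unit; a message sent during a round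
`[k * Δ, (k + 1) * Δ)` is delivered precisely at time `(k + 1) * Δ`. -/
structure FaultySynchronous (x : Execution P) (Δ : ℕ) (E : Finset (Fin n)) : Prop where
  faulty : ∀ p ∈ E, x.crashAt p = 0
  correct : ∀ p ∉ E, x.Correct p
  instantaneous : ∀ t, ∀ p ∉ E, x.active t p
  delivery : ∀ τ s q, q ∉ E → (x.sent τ s q).isSome → (s, τ) ∈ x.inbox ((τ / Δ + 1) * Δ) q

/-- `p` decides a value by time `2Δ`. -/
def TwoStepFor (x : Execution P) (Δ : ℕ) (p : Fin n) : Prop :=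
  ∃ t w, t ≤ 2 * Δ ∧ x.output t p = some w

/-- `propose` is called exactly once, at process `p`, with argument `v`. -/
def SoloProposal (x : Execution P) (p : Fin n) (v : V) : Prop :=
  ∃ i, x.invoke i p = some v ∧ ∀ t q, (t, q) ≠ (i, p) → x.invoke t q = none

/-- The calls of `propose` are exactly one call of `propose(v)` by each process outside `E`, at
the beginning of the first round. -/
def CommonProposal (x : Execution P) (E : Finset (Fin n)) (v : V) : Prop :=
  (∀ q ∉ E, x.invoke 0 q = some v) ∧ ∀ t q, (t ≠ 0 ∨ q ∈ E) → x.invoke t q = none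

end Execution

namespace Protocol

variable {n : ℕ} {V : Type u}

/-- The protocol implements a linearizable, wait-free consensus object under at most `f` process
failures. -/
def Resilient (P : Protocol n V) (Δ f : ℕ) : Prop :=
  ∀ x : Execution P, x.IsRun Δ → {p | ¬ x.Correct p}.ncard ≤ f → x.Linearizable ∧ x.WaitFree

/-- The protocol is `e`-two-step (as a consensus object). -/
def TwoStep (P : Protocol n V) (Δ e : ℕ) : Prop :=
  ∀ E : Finset (Fin n), E.card = e → ∀ v : V, ∀ p ∉ E,
    (∃ x : Execution P, x.IsRun Δ ∧ x.FaultySynchronous Δ E ∧ x.SoloProposal p v ∧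
      x.TwoStepFor Δ p) ∧
    (∃ x : Execution P, x.IsRun Δ ∧ x.FaultySynchronous Δ E ∧ x.CommonProposal E v ∧
      x.TwoStepFor Δ p)

end Protocol

/-! ### Legal histories and linearizability -/

/-! For consensus, linearizability amounts to agreement and validity: returns answer calls, and they
all carry the argument of one call, made no later than the first return. That call is linearized
first, the others in the order of their call times.

If `n ≤ 2f`, split the processes into two halves of at most `f`. Each half decides its own proposal
when the other has crashed. If the messages between the halves are delayed until both have decided,
two values are returned in one run.

Let `n ≤ 2e + f - 2` and `2f + 1 ≤ n`. Take disjoint sets `E₀`, `E₁` of `e` processes, and two solo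
runs: in one `E₀` has crashed and a member of `E₁` proposes, in the other the roles are exchanged.
Declare faulty the two proposers and the `n - 2e` processes outside both sets; these are at most
`f`. Every survivor follows the run in which it is correct. Nothing is received before time `Δ`, so
first-round behaviour depends on a process's own calls only. In the second round the faulty
processes can complete either solo run, so that its proposer decides by `2Δ`, while their
second-round messages to the survivors are held back. A survivor `c` that calls `propose` at `2Δ +
1` sees the same as if all faulty processes had crashed at time `Δ`. Hence it returns the same value
in both cases, and this value must be both proposals (`SoloPair.value_eq`).

Conversely, a variant of Fast Paxos works. In ballot `0` a process votes at most once and never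
against its own input; a proposer decides with `n - e` votes, its own included. Later ballots are
Paxos ballots with quorums of `n - f`. If such a ballot, with quorum `Q`, sees neither a fast
decision nor a slow vote, then the proposers in `Q` have not decided in ballot `0` and never will,
so their supporters are disregarded. Let `p₀` have decided `w` and let `q₀ ∉ Q` be a proposer of
another value. Both lie outside `Q` and outside the set `S` of the at least `n - e - 1` other voters
of `p₀`. Hence `|S ∩ Q| ≥ |Q| - e + 1 ≥ n - e - f + 1`, while `q₀` has at most `e - 1` supporters in
`Q`. As `n ≥ 2e + f - 1`, the best supported value is `w`. This is `eq_of_fast_of_isMostSupported`;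
`IsProposed.safe` extends it to all ballots by induction. Liveness comes from an eventually unique
leader (`exists_eventual_leader`), and slow ballots start too late to disturb two-step runs. -/

theorem LegalFrom.result_eq_of_some {V : Type u} {w : V} :
    ∀ {l : List (V × V)}, LegalFrom (some w) l → ∀ a ∈ l, a.2 = w
  | [], _, a, ha => by simp at ha
  | (v, r) :: l, h, a, ha => by
    obtain ⟨h1, h2⟩ := h
    rcases List.mem_cons.1 ha with rfl | ha
    · exact h1
    · exact LegalFrom.result_eq_of_some h2 a ha

theorem LegalFrom.exists_result {V : Type u} {l : List (V × V)} (h : LegalFrom none l)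
    (hl : l ≠ []) : ∃ w, (∃ b ∈ l, b.1 = w) ∧ ∀ a ∈ l, a.2 = w := by
  match l, h with
  | (v, r) :: l, h =>
    obtain ⟨h1, h2⟩ := h
    refine ⟨v, ⟨(v, r), by simp, rfl⟩, fun a ha => ?_⟩
    rcases List.mem_cons.1 ha with rfl | ha
    · exact h1
    · exact LegalFrom.result_eq_of_some h2 a ha

theorem LegalFrom.of_forall_eq {V : Type u} {w : V} :
    ∀ {l : List (V × V)}, (∀ a ∈ l, a.2 = w) → LegalFrom (some w) l
  | [], _ => trivial
  | (v, r) :: l, h => ⟨h (v, r) (by simp), LegalFrom.of_forall_eq fun a ha => h a (by simp [ha])⟩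

namespace Execution

variable {n : ℕ} {V : Type u} {P : Protocol n V}

/-- Both returns lie in the prefix up to the later of the two times. Its linearization contains both
calls, and all results in a legal history equal the argument of its first operation. -/
theorem Linearizable.exists_common_output {x : Execution P} (h : x.Linearizable) {t t' : ℕ}
    {p p' : Fin n} {w w' : V} (hw : x.output t p = some w) (hw' : x.output t' p' = some w') :
    w = w' ∧ ∃ i q, x.invoke i q = some w := by
  obtain ⟨hwf, hlin⟩ := h
  obtain ⟨i, hi⟩ := hwf t p w hw
  obtain ⟨i', hi'⟩ := hwf t' p' w' hw'
  obtain ⟨L, hL⟩ := hlin (max t t')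
  obtain ⟨a, ha⟩ := Option.isSome_iff_exists.1 hi.1
  obtain ⟨a', ha'⟩ := Option.isSome_iff_exists.1 hi'.1
  have h1 := hL.complete ⟨p, i, a⟩ t w ha (le_max_left _ _) hi
  have h2 := hL.complete ⟨p', i', a'⟩ t' w' ha' (le_max_right _ _) hi'
  obtain ⟨z, ⟨b, hb, hbz⟩, hz⟩ := hL.legal.exists_result
    (by intro h0; rw [List.map_eq_nil_iff] at h0; simp [h0] at h1)
  have e1 : w = z := hz _ (List.mem_map.2 ⟨_, h1, rfl⟩)
  have e2 : w' = z := hz _ (List.mem_map.2 ⟨_, h2, rfl⟩)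
  obtain ⟨o, ho, rfl⟩ := List.mem_map.1 hb
  refine ⟨e1.trans e2.symm, o.1.time, o.1.proc, ?_⟩
  rw [(hL.invoked o ho).2, e1, ← hbz]

theorem Linearizable.output_eq {x : Execution P} (h : x.Linearizable) {t t' : ℕ}
    {p p' : Fin n} {w w' : V} (hw : x.output t p = some w) (hw' : x.output t' p' = some w') :
    w = w' := (h.exists_common_output hw hw').1

theorem Linearizable.output_eq_of_invoke {x : Execution P} (h : x.Linearizable) {t : ℕ}
    {p : Fin n} {v w : V} (hv : ∀ i q u, x.invoke i q = some u → u = v)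
    (hw : x.output t p = some w) : w = v := by
  obtain ⟨-, i, q, hq⟩ := h.exists_common_output hw hw
  exact hv i q w hq

theorem finite_setOf_invoked (x : Execution P) (T : ℕ) :
    {o : ProposeOp n V | o.time ≤ T ∧ x.invoke o.time o.proc = some o.arg}.Finite := by
  refine Set.Finite.of_injOn (f := fun o => (o.proc, o.time)) (t := Set.univ ×ˢ Set.Iic T)
    (fun o ho => ⟨trivial, ho.1⟩) ?_ (Set.finite_univ.prod (Set.finite_Iic T))
  rintro ⟨p, i, v⟩ ho ⟨p', i', v'⟩ ho' heq
  obtain ⟨rfl, rfl⟩ := Prod.mk.inj heq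
  have := ho.2.symm.trans ho'.2
  simp_all

/-- A call with the common value, made by the time of the first return, is put first even if it is
still pending. Every later operation then legally returns that value. -/
theorem linearizable_of_agreement {x : Execution P} (hwf : x.WellFormed)
    (hagree : ∀ t t' p p' w w', x.output t p = some w → x.output t' p' = some w' → w = w')
    (hvalid : ∀ t p w, x.output t p = some w → ∃ i ≤ t, ∃ q, x.invoke i q = some w) :
    x.Linearizable := by
  classical
  refine ⟨hwf, fun T => ?_⟩
  by_cases hout : ∃ t, ∃ p w, x.output t p = some w
  swap
  · refine ⟨[], by simp, by simp, fun a t w _ _ hr => ?_, by simp, trivial⟩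
    exact (hout ⟨t, a.proc, w, hr.2.2.1⟩).elim
  obtain ⟨p₀, w, hw⟩ := Nat.find_spec hout
  have hmin : ∀ t p w, x.output t p = some w → Nat.find hout ≤ t :=
    fun t p w h => Nat.find_min' hout ⟨p, w, h⟩
  set t₀ := Nat.find hout
  by_cases hT : t₀ ≤ T
  swap
  · refine ⟨[], by simp, by simp, fun a t w _ ht hr => ?_, by simp, trivial⟩
    exact (hT ((hmin _ _ _ hr.2.2.1).trans ht)).elim
  obtain ⟨i, hi, q, hq⟩ := hvalid _ _ _ hw
  let O := ((x.finite_setOf_invoked T).toFinset.erase ⟨q, i, w⟩).toList.insertionSort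
    fun a b => a.time ≤ b.time
  have hO : ∀ o, o ∈ O ↔ o ≠ ⟨q, i, w⟩ ∧ o.time ≤ T ∧ x.invoke o.time o.proc = some o.arg := by
    intro o; simp [O, List.mem_insertionSort]
  have hOn : O.Nodup := (List.perm_insertionSort _ _).nodup_iff.2 (Finset.nodup_toList _)
  have : Std.Total (fun a b : ProposeOp n V => a.time ≤ b.time) := ⟨fun a b => le_total _ _⟩
  have : IsTrans (ProposeOp n V) (fun a b => a.time ≤ b.time) := ⟨fun a b c => le_trans⟩
  have hOs : O.Pairwise fun a b => a.time ≤ b.time := List.pairwise_insertionSort _ _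
  -- All other pending calls are dropped.
  let R := O.filter fun o => ∃ t ≤ T, ∃ w, x.Returns o.proc o.time t w
  have hR : ∀ o, o ∈ R ↔ o ∈ O ∧ ∃ t ≤ T, ∃ w, x.Returns o.proc o.time t w := by
    intro o; simp [R]
  refine ⟨(⟨q, i, w⟩, w) :: R.map fun o => (o, w), ?_, ?_, ?_, ?_, ?_⟩
  · simp only [List.map_cons, List.map_map]
    refine List.nodup_cons.2 ⟨?_, ?_⟩
    · simp [hR, hO]
    · simpa [Function.comp_def] using (hOn.filter _ : R.Nodup)
  · intro o ho
    rcases List.mem_cons.1 ho with rfl | ho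
    · exact ⟨hi.trans hT, hq⟩
    · obtain ⟨o, ho', rfl⟩ := List.mem_map.1 ho
      exact ((hO o).1 ((hR o).1 ho').1).2
  · intro a t w' ha ht hr
    obtain rfl := hagree _ _ _ _ _ _ hw hr.2.2.1
    by_cases h : a = ⟨q, i, w⟩
    · simp [h]
    · exact List.mem_cons_of_mem _ (List.mem_map.2 ⟨a, (hR a).2
        ⟨(hO a).2 ⟨h, hr.2.1.trans ht, ha⟩, t, ht, w, hr⟩, rfl⟩)
  · refine List.pairwise_cons.2 ⟨?_, ?_⟩
    -- No call returns before `t₀`, and the first operation is called by `t₀`, so nothing precedes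
    -- it.
    · rintro b - ⟨t, w', hr, ht⟩
      have := hmin _ _ _ hr.2.2.1
      dsimp at ht
      omega
    · refine List.Pairwise.map _ (fun a b hab => ?_) (hOs.filter _)
      rintro ⟨t, w', hr, ht⟩
      have := hr.2.1
      dsimp at ht this hab
      omega
  · refine ⟨rfl, LegalFrom.of_forall_eq ?_⟩
    simp

end Execution

/-! ### Executions generated by a schedule -/

namespace Execution

variable {n : ℕ} {V : Type u} {P : Protocol n V}

/-- Two runs coincide on a causally closed set of pairs (time, process) on which they have the
same active processes, calls and deliveries. -/
theorem IsRun.agree {Δ Δ' : ℕ} {x y : Execution P} (hx : x.IsRun Δ) (hy : y.IsRun Δ')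
    (R : ℕ → Fin n → Prop) (hdown : ∀ t p, R (t + 1) p → R t p)
    (hact : ∀ t p, R t p → (x.active t p ↔ y.active t p))
    (hinv : ∀ t p, R t p → x.invoke t p = y.invoke t p)
    (hinbox : ∀ t p, R t p → (∀ τ < t, ∀ s, R τ s → x.sent τ s = y.sent τ s) →
      x.inbox t p = y.inbox t p)
    (hsrc : ∀ t p, R t p → ∀ m ∈ x.inbox t p, R m.2 m.1) :
    ∀ t p, R t p → x.state t p = y.state t p ∧ x.sent t p = y.sent t p ∧
      x.output t p = y.output t p := by
  intro t
  induction t using Nat.strong_induction_on with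
  | _ t ih =>
  have hnext : ∀ p, R t p → x.state t p = y.state t p →
      (x.state (t + 1) p, x.sent t p, x.output t p) =
        (y.state (t + 1) p, y.sent t p, y.output t p) := by
    intro p hp hst
    have hin := hinbox t p hp fun τ hτ s hs => (ih τ hτ s hs).2.1
    by_cases ha : x.active t p
    · have hrec : x.received t p = y.received t p := by
        unfold received
        rw [← hin]
        refine List.filterMap_congr fun m hm => ?_
        rw [(ih m.2 (hx.no_creation t p m.1 m.2 hm).1 m.1 (hsrc t p hp m hm)).2.1]
      rw [hx.step t p ha, hy.step t p ((hact t p hp).1 ha), hst, hinv t p hp, hrec]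
    · obtain ⟨a1, a2, a3, -⟩ := hx.idle t p ha
      obtain ⟨b1, b2, b3, -⟩ := hy.idle t p fun h => ha ((hact t p hp).2 h)
      have : x.sent t p = y.sent t p := funext fun q => (a2 q).trans (b2 q).symm
      rw [a1, b1, this, a3, b3, hst]
  -- The state before time `t` results from the step at `t - 1`, which lies in the region by
  -- `hdown`.
  have hstate : ∀ p, R t p → x.state t p = y.state t p := by
    intro p hp
    cases t with
    | zero => rw [hx.start, hy.start]
    | succ t =>
      have hp' := hdown t p hp
      have hin := hinbox t p hp' fun τ hτ s hs => (ih τ (by omega) s hs).2.1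
      have hst := (ih t (by omega) p hp').1
      by_cases ha : x.active t p
      · have hrec : x.received t p = y.received t p := by
          unfold received
          rw [← hin]
          refine List.filterMap_congr fun m hm => ?_
          rw [(ih m.2 ((hx.no_creation t p m.1 m.2 hm).1.trans (by omega)) m.1
            (hsrc t p hp' m hm)).2.1]
        have h1 := hx.step t p ha
        have h2 := hy.step t p ((hact t p hp').1 ha)
        rw [hst, hinv t p hp', hrec, ← h2] at h1
        exact (Prod.mk.inj h1).1
      · rw [(hx.idle t p ha).1, (hy.idle t p fun h => ha ((hact t p hp').2 h)).1, hst]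
  intro p hp
  have h := hnext p hp (hstate p hp)
  simp only [Prod.mk.injEq] at h
  exact ⟨hstate p hp, h.2⟩

end Execution

/-- The choices of the environment in a run. The deliveries at time `t` to `q` are those messages
of the list `deliver t q` that have been sent. -/
structure Schedule (n : ℕ) (V : Type u) where
  crashAt : Fin n → ℕ∞
  active : ℕ → Fin n → Prop
  invoke : ℕ → Fin n → Option V
  deliver : ℕ → Fin n → List (Fin n × ℕ)

namespace Schedule

variable {n : ℕ} {V : Type u} (σ : Schedule n V) (P : Protocol n V)

open Classical in
/-- The states before time `t` and the messages sent before time `t`. -/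
noncomputable def history : ℕ → (Fin n → P.State) × (ℕ → Fin n → Fin n → Option P.Msg)
  | 0 => (P.init, fun _ _ _ => none)
  | t + 1 =>
    let h := history t
    let out := fun p => if σ.active t p then
        P.step p (h.1 p) (σ.invoke t p) (((σ.deliver t p).filter fun m =>
          m.2 < t ∧ (h.2 m.2 m.1 p).isSome).filterMap fun m =>
            (h.2 m.2 m.1 p).map fun c => (m.1, c))
      else (h.1 p, fun _ => none, none)
    (fun p => (out p).1, fun τ => if τ = t then fun p => (out p).2.1 else h.2 τ)

open Classical in
/-- The execution produced by a schedule. -/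
noncomputable def run : Execution P where
  crashAt := σ.crashAt
  active := σ.active
  invoke t p := if σ.active t p then σ.invoke t p else none
  inbox t q := if σ.active t q then (σ.deliver t q).filter fun m =>
    m.2 < t ∧ ((σ.history P t).2 m.2 m.1 q).isSome else []
  state t := (σ.history P t).1
  sent t := (σ.history P (t + 1)).2 t
  output t p := if σ.active t p then
    (P.step p ((σ.history P t).1 p) (σ.invoke t p) (((σ.deliver t p).filter fun m =>
      m.2 < t ∧ ((σ.history P t).2 m.2 m.1 p).isSome).filterMap fun m =>
        ((σ.history P t).2 m.2 m.1 p).map fun c => (m.1, c))).2.2 else none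

/-- Each stage of `history` adds the row of its own time and leaves earlier rows untouched, so
deliveries computed from a partial history agree with the complete run. -/
theorem history_sent {τ t : ℕ} (h : τ < t) : (σ.history P t).2 τ = (σ.run P).sent τ := by
  induction t with
  | zero => omega
  | succ t ih =>
    rcases Nat.lt_succ_iff_lt_or_eq.1 h with h | rfl
    · rw [← ih h]
      simp [history, h.ne]
    · rfl

open Classical in
theorem run_inbox (t : ℕ) (q : Fin n) : (σ.run P).inbox t q =
    if σ.active t q then (σ.deliver t q).filter fun m =>
      m.2 < t ∧ ((σ.run P).sent m.2 m.1 q).isSome else [] := by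
  simp only [run]
  split_ifs
  · refine List.filter_congr fun m _ => ?_
    by_cases h : m.2 < t
    · rw [history_sent σ P h]; rfl
    · simp [h]
  · rfl

theorem mem_run_inbox {t : ℕ} {q : Fin n} {m : Fin n × ℕ} : m ∈ (σ.run P).inbox t q ↔
    σ.active t q ∧ m ∈ σ.deliver t q ∧ m.2 < t ∧ ((σ.run P).sent m.2 m.1 q).isSome := by
  classical
  rw [run_inbox]
  split_ifs with h <;> simp [h]

/-- At most one call per process is demanded, which gives sequentiality without any knowledge of the
returns. Only timeliness has to be checked on the generated run. -/
theorem run_isRun {Δ : ℕ} (hcrash : ∀ t p, σ.active t p → (t : ℕ∞) < σ.crashAt p)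
    (hnodup : ∀ t q, (σ.deliver t q).Nodup)
    (hdup : ∀ t t' q m, m ∈ σ.deliver t q → m ∈ σ.deliver t' q → t = t')
    (hseq : ∀ p i j, (σ.invoke i p).isSome → (σ.invoke j p).isSome → i = j)
    (hsync : ∃ GST, (σ.run P).TimelyFrom Δ GST) : (σ.run P).IsRun Δ where
  start p := rfl
  step t p h := by
    replace h : σ.active t p := h
    have hrec : (σ.run P).received t p = ((σ.deliver t p).filter fun m =>
      m.2 < t ∧ ((σ.history P t).2 m.2 m.1 p).isSome).filterMap fun m =>
        ((σ.history P t).2 m.2 m.1 p).map fun c => (m.1, c) := by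
      have : (σ.run P).inbox t p = (σ.deliver t p).filter fun m =>
        m.2 < t ∧ ((σ.history P t).2 m.2 m.1 p).isSome := by simp [run, h]
      rw [Execution.received, this]
      refine List.filterMap_congr fun m hm => ?_
      have hm : m.2 < t := by simp at hm; exact hm.2.1
      rw [history_sent σ P hm]
    rw [hrec]
    simp [run, history, h]
  idle t p h := by
    replace h : ¬ σ.active t p := h
    simp [run, history, h]
  crash := hcrash
  no_creation t q s τ h := ((mem_run_inbox σ P).1 h).2.2
  nodup t q := by
    classical
    rw [run_inbox]
    split_ifs
    · exact (hnodup t q).filter _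
    · exact List.nodup_nil
  no_duplication t t' q m h h' :=
    hdup t t' q m ((mem_run_inbox σ P).1 h).2.1 ((mem_run_inbox σ P).1 h').2.1
  sequential p i j hij hi hj := by
    have aux : ∀ i, ((σ.run P).invoke i p).isSome → (σ.invoke i p).isSome := by
      intro i hi
      by_contra h
      simp only [run] at hi
      split_ifs at hi <;> simp_all
    exact absurd (hseq p i j (aux i hi) (aux j hj)) hij.ne
  partially_synchronous := hsync

end Schedule

/-- All conceivable messages sent before time `t`, in some order. -/
noncomputable def messagesBefore (n t : ℕ) : List (Fin n × ℕ) :=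
  (Finset.univ ×ˢ Finset.range t).toList

@[simp] theorem mem_messagesBefore {n t : ℕ} {m : Fin n × ℕ} :
    m ∈ messagesBefore n t ↔ m.2 < t := by
  simp [messagesBefore]

theorem nodup_messagesBefore (n t : ℕ) : (messagesBefore n t).Nodup := Finset.nodup_toList _

/-! ### The bound `2f + 1 ≤ n` -/

section Partition

variable {n : ℕ} {V : Type u}

open Classical in
/-- The processes split into those in `A` and the others. Those in `C` crash at the beginning,
messages within a side take one time unit, and messages between the sides arrive after time `T`.
Each `p` calls `propose (val p)` at time `0` if `val p` is a value. -/
noncomputable def partitionSchedule (A C : Finset (Fin n)) (val : Fin n → Option V) (T : ℕ) :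
    Schedule n V where
  crashAt p := if p ∈ C then 0 else ⊤
  active _ p := p ∉ C
  invoke t p := if t = 0 then val p else none
  deliver t q := (messagesBefore n t).filter fun m =>
    t = if m.1 ∈ A ↔ q ∈ A then m.2 + 1 else max m.2 T + 1

theorem partitionSchedule_isRun (P : Protocol n V) {Δ : ℕ} (hΔ : 0 < Δ) (A C : Finset (Fin n))
    (val : Fin n → Option V) (T : ℕ) : ((partitionSchedule A C val T).run P).IsRun Δ := by
  apply Schedule.run_isRun
  · intro t p hp
    simp only [partitionSchedule] at hp ⊢
    simp [hp]
  · exact fun t q => (nodup_messagesBefore n t).filter _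
  · intro t t' q m h h'
    simp only [partitionSchedule, List.mem_filter, decide_eq_true_eq] at h h'
    exact h.2.trans h'.2.symm
  · intro p i j hi hj
    simp only [partitionSchedule] at hi hj
    split_ifs at hi hj <;> simp_all
  -- With `GST = T`, a message between the sides arrives at `max τ T + 1`, within the bound since `Δ
  -- ≥ 1`.
  · refine ⟨T, ?_, ?_⟩
    · intro t p _ hp
      simp only [partitionSchedule, Schedule.run] at hp ⊢
      intro h
      simp [h] at hp
    · intro τ s q hs _ hq
      have hqC : q ∉ C := by
        intro h
        simp [Schedule.run, partitionSchedule, h] at hq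
      refine ⟨if s ∈ A ↔ q ∈ A then τ + 1 else max τ T + 1, ?_, ?_⟩
      · split_ifs
        · have := le_max_left τ T; omega
        · omega
      · rw [Schedule.mem_run_inbox]
        refine ⟨hqC, ?_, ?_, hs⟩
        · simp only [partitionSchedule, List.mem_filter, mem_messagesBefore, decide_eq_true_eq,
            and_true]
          split_ifs <;> omega
        · dsimp
          split_ifs <;> omega

open Classical in
theorem partitionSchedule_inbox (P : Protocol n V) (A C : Finset (Fin n))
    (val : Fin n → Option V) (T t : ℕ) (q : Fin n) (hq : q ∉ C) :
    ((partitionSchedule A C val T).run P).inbox t q = (messagesBefore n t).filter fun m =>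
      (((partitionSchedule A C val T).run P).sent m.2 m.1 q).isSome ∧
        t = if m.1 ∈ A ↔ q ∈ A then m.2 + 1 else max m.2 T + 1 := by
  rw [Schedule.run_inbox, if_pos (by exact hq)]
  generalize ((partitionSchedule A C val T).run P).sent = g
  simp only [partitionSchedule, List.filter_filter]
  refine List.filter_congr fun m hm => ?_
  rw [mem_messagesBefore] at hm
  simp [hm]

theorem partitionSchedule_correct (P : Protocol n V) (A C : Finset (Fin n))
    (val : Fin n → Option V) (T : ℕ) (p : Fin n) :
    ((partitionSchedule A C val T).run P).Correct p ↔ p ∉ C := by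
  simp only [Execution.Correct, Schedule.run, partitionSchedule]
  split_ifs with h <;> simp [h]

/-- Up to time `T`, a process in `B` does not notice the difference between a run in which the
processes outside `B` have crashed and a run in which the messages of these are delayed. -/
theorem partitionSchedule_agree (P : Protocol n V) {Δ : ℕ} (hΔ : 0 < Δ) (A B : Finset (Fin n))
    (hB : B = A ∨ B = Aᶜ) (val : Fin n → Option V) (T t : ℕ) (ht : t ≤ T) (p : Fin n)
    (hp : p ∈ B) : ((partitionSchedule A Bᶜ val 0).run P).output t p =
      ((partitionSchedule A ∅ val T).run P).output t p := by
  have hx := partitionSchedule_isRun P hΔ A Bᶜ val 0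
  have hside : ∀ s q : Fin n, q ∈ B → ((s ∈ A ↔ q ∈ A) ↔ s ∈ B) := by
    intro s q hq
    rcases hB with rfl | rfl <;> simp_all
  refine (hx.agree (partitionSchedule_isRun P hΔ A ∅ val T) (fun t p => t ≤ T ∧ p ∈ B)
    (fun t p h => ⟨by omega, h.2⟩) ?_ ?_ ?_ ?_ t p ⟨ht, hp⟩).2.2
  · intro t p h
    simp [Schedule.run, partitionSchedule, h.2]
  · intro t p h
    simp [Schedule.run, partitionSchedule, h.2]
  · intro t q h ih
    rw [partitionSchedule_inbox P A Bᶜ val 0 t q (by simpa using h.2),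
      partitionSchedule_inbox P A ∅ val T t q (by simp)]
    refine List.filter_congr fun m hm => ?_
    rw [mem_messagesBefore] at hm
    by_cases hs : m.1 ∈ B
    · rw [ih m.2 hm m.1 ⟨by omega, hs⟩]
      simp [(hside m.1 q h.2).2 hs]
    · have hidle := hx.idle m.2 m.1 (by simp [Schedule.run, partitionSchedule, hs])
      rw [hidle.2.1 q]
      have : ¬ (m.1 ∈ A ↔ q ∈ A) := fun h' => hs ((hside m.1 q h.2).1 h')
      simp only [this, if_false]
      -- A message from the other side arrives only after `T ≥ t`.
      have : t ≠ max m.2 T + 1 := by omega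
      simp [this]
  · intro t q h m hm
    obtain ⟨-, -, h3, h4⟩ := (Schedule.mem_run_inbox _ _).1 hm
    refine ⟨by omega, ?_⟩
    by_contra hs
    have hidle := hx.idle m.2 m.1 (by simp [Schedule.run, partitionSchedule, hs])
    simp [hidle.2.1 q] at h4

theorem Protocol.Resilient.two_mul_add_one_le [Nontrivial V] {f Δ : ℕ} (hn : 3 ≤ n) (hΔ : 0 < Δ)
    {P : Protocol n V} (hP : P.Resilient Δ f) : 2 * f + 1 ≤ n := by
  by_contra hlt
  obtain ⟨v, w, hvw⟩ := exists_pair_ne V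
  let a : Fin n := ⟨0, by omega⟩
  let b : Fin n := ⟨n - 1, by omega⟩
  -- As `n ≤ 2f`, both `A` and its complement have at most `f` elements.
  let A : Finset (Fin n) := Finset.Iio ⟨n / 2, by omega⟩
  have haA : a ∈ A := by simp [A, a]; omega
  have hbA : b ∉ A := by simp [A, b]; omega
  have hcard : A.card = n / 2 := by simp [A]
  have hcardc : Aᶜ.card = n - n / 2 := by rw [Finset.card_compl, hcard, Fintype.card_fin]
  let val : Fin n → Option V := fun p => if p = a then some v else if p = b then some w else none
  have hab : b ≠ a := fun h => hbA (h ▸ haA)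
  have key : ∀ B : Finset (Fin n), B = A ∨ B = Aᶜ → ∀ c ∈ B, ∀ u, val c = some u →
      (∀ q ∈ B, ∀ u', val q = some u' → u' = u) →
      ∃ t, ((partitionSchedule A Bᶜ val 0).run P).output t c = some u := by
    intro B hB c hc u hu huniq
    have hf : {p | ¬ ((partitionSchedule A Bᶜ val 0).run P).Correct p}.ncard ≤ f := by
      simp only [partitionSchedule_correct, not_not]
      rw [show {p | p ∈ Bᶜ} = ((Bᶜ : Finset (Fin n)) : Set (Fin n)) from rfl,
        Set.ncard_coe_finset]
      rcases hB with rfl | rfl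
      · omega
      · rw [compl_compl]; omega
    obtain ⟨hlin, hwait⟩ := hP _ (partitionSchedule_isRun P hΔ A Bᶜ val 0) hf
    obtain ⟨t, z, hz⟩ := hwait c 0 ((partitionSchedule_correct ..).2 (by simpa using hc))
      (by simp [Schedule.run, partitionSchedule, hc, hu])
    refine ⟨t, hz.2.2.1.trans (congrArg some (hlin.output_eq_of_invoke ?_ hz.2.2.1))⟩
    intro i q u' hi
    simp only [Schedule.run, partitionSchedule] at hi
    by_cases hq : q ∈ B
    · by_cases hi0 : i = 0
      · exact huniq q hq u' (by simpa [hq, hi0] using hi)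
      · simp [hi0] at hi
    · simp [hq] at hi
  obtain ⟨t₁, h₁⟩ := key A (Or.inl rfl) a haA v (by simp [val]) (by
    intro q hq u' hu'
    have : q ≠ b := fun h => hbA (h ▸ hq)
    simp only [val, this, if_false] at hu'
    split_ifs at hu'
    simpa using hu'.symm)
  obtain ⟨t₂, h₂⟩ := key Aᶜ (Or.inr rfl) b (by simpa using hbA) w (by simp [val, hab]) (by
    intro q hq u' hu'
    have : q ≠ a := fun h => (Finset.mem_compl.1 hq) (h ▸ haA)
    simp only [val, this, if_false] at hu'
    split_ifs at hu'
    simpa using hu'.symm)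
  -- The delay exceeds both decision times, so both decisions survive in the joint run, which has no
  -- faults.
  rw [partitionSchedule_agree P hΔ A A (Or.inl rfl) val (max t₁ t₂) t₁ (le_max_left _ _) a haA]
    at h₁
  rw [partitionSchedule_agree P hΔ A Aᶜ (Or.inr rfl) val (max t₁ t₂) t₂ (le_max_right _ _) b
    (by simpa using hbA)] at h₂
  have hf : {p | ¬ ((partitionSchedule A ∅ val (max t₁ t₂)).run P).Correct p}.ncard ≤ f := by
    simp [partitionSchedule_correct]
  exact hvw ((hP _ (partitionSchedule_isRun P hΔ A ∅ val _) hf).1.output_eq h₁ h₂)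

end Partition

/-! ### The bound `2e + f - 1 ≤ n` -/

namespace Execution

variable {n : ℕ} {V : Type u} {P : Protocol n V}

/-- Crashed processes take no step, hence neither send nor receive. As no message is delivered
twice, the prescribed delivery time is the only one. -/
theorem FaultySynchronous.of_mem_inbox {x : Execution P} {Δ : ℕ} {E : Finset (Fin n)}
    (hx : x.IsRun Δ) (hE : x.FaultySynchronous Δ E) {t τ : ℕ} {s q : Fin n}
    (h : (s, τ) ∈ x.inbox t q) :
    s ∉ E ∧ q ∉ E ∧ t = (τ / Δ + 1) * Δ ∧ τ < t ∧ (x.sent τ s q).isSome := by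
  obtain ⟨h1, h2⟩ := hx.no_creation t q s τ h
  have hact : ∀ t p, p ∈ E → ¬ x.active t p := fun t p hp ha => by
    have := hx.crash t p ha
    simp [hE.faulty p hp] at this
  have hq : q ∉ E := fun hq => by
    simp [(hx.idle t q (hact t q hq)).2.2.2.2] at h
  refine ⟨fun hs => ?_, hq, hx.no_duplication _ _ _ _ h (hE.delivery τ s q hq h2), h1, h2⟩
  simp [(hx.idle τ s (hact τ s hs)).2.1 q] at h2

theorem SoloProposal.eq_of_isSome {x : Execution P} {p : Fin n} {v : V} (h : x.SoloProposal p v)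
    {i j : ℕ} {q r : Fin n} (hi : (x.invoke i q).isSome) (hj : (x.invoke j r).isSome) :
    i = j ∧ q = p := by
  obtain ⟨k, -, hk⟩ := h
  have aux : ∀ i q, (x.invoke i q).isSome → (i, q) = (k, p) := by
    intro i q hi
    by_contra h
    simp [hk i q h] at hi
  have h1 := aux i q hi
  have h2 := aux j r hj
  simp_all

theorem SoloProposal.invoke_eq_none {x : Execution P} {p : Fin n} {v : V}
    (h : x.SoloProposal p v) (i : ℕ) {q : Fin n} (hq : q ≠ p) : x.invoke i q = none := by
  obtain ⟨k, -, hk⟩ := h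
  exact hk i q (by simp [hq])

end Execution

/-- Two synchronous runs, in each of which a single process, that has crashed in the other run,
makes the only call of `propose`. -/
structure SoloPair {n : ℕ} {V : Type u} (P : Protocol n V) (Δ : ℕ) where
  run : Bool → Execution P
  faulty : Bool → Finset (Fin n)
  proposer : Bool → Fin n
  value : Bool → V
  isRun : ∀ b, (run b).IsRun Δ
  synchronous : ∀ b, (run b).FaultySynchronous Δ (faulty b)
  solo : ∀ b, (run b).SoloProposal (proposer b) (value b)
  proposer_notMem : ∀ b, proposer b ∉ faulty b
  proposer_mem : ∀ b, proposer b ∈ faulty (!b)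
  pos : 0 < Δ

namespace SoloPair

variable {n : ℕ} {V : Type u} {P : Protocol n V} {Δ : ℕ} (S : SoloPair P Δ)

/-- The processes that crash when the two runs are spliced. -/
def spliceFaulty : Finset (Fin n) :=
  {S.proposer false, S.proposer true} ∪ (S.faulty false ∪ S.faulty true)ᶜ

theorem mem_spliceFaulty {p : Fin n} : p ∈ S.spliceFaulty ↔
    p = S.proposer false ∨ p = S.proposer true ∨ p ∉ S.faulty false ∧ p ∉ S.faulty true := by
  simp [spliceFaulty]

/-- The run that a process follows after splicing. -/
def side (p : Fin n) : Bool := decide (p ∈ S.faulty false)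

/-- A survivor belongs to at least one of the two crash sets, so if it is correct in run `b`, it has
crashed in the other one. -/
theorem side_eq {p : Fin n} {b : Bool} (hp : p ∉ S.spliceFaulty) (hb : p ∉ S.faulty b) :
    S.side p = b := by
  rw [mem_spliceFaulty] at hp
  push Not at hp
  cases b
  · simpa [side] using hb
  · have := hp.2.2
    simp only [side, decide_eq_true_eq]
    tauto

theorem side_proposer (b : Bool) : S.side (S.proposer b) = b := by
  have h1 := S.proposer_notMem b
  have h2 := S.proposer_mem b
  cases b <;> simpa [side] using ‹_›

/-- The deliveries up to time `2Δ`. -/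
def early (b : Bool) (t : ℕ) (q : Fin n) : List (Fin n × ℕ) :=
  if q ∈ S.spliceFaulty then (S.run b).inbox t q
  else if t < 2 * Δ then (S.run (S.side q)).inbox t q else []

/-- The delivery time of the messages that are not delivered early. -/
def late (T : ℕ) (m : Fin n × ℕ) : ℕ :=
  if m.1 ∉ S.spliceFaulty ∨ m.2 < Δ then max m.2 (2 * Δ) + 1 else max m.2 (max T (2 * Δ)) + 1

open Classical in
/-- The splice of two runs: the processes in `S.spliceFaulty` crash, `p` at time `K p`, and follow
the run `b` before; the other ones follow the run in which they are correct, up to time `2Δ`.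
The messages from the faulty processes sent from time `Δ` on reach the correct ones after
time `T` only. The process `c` calls `propose u` at time `2Δ + 1`. -/
noncomputable def splice (c : Fin n) (u : V) (b : Bool) (K : Fin n → ℕ) (T : ℕ) :
    Schedule n V where
  crashAt p := if p ∈ S.spliceFaulty then (K p : ℕ∞) else ⊤
  active t p := p ∈ S.spliceFaulty → t < K p
  invoke t p := if p = c then (if t = 2 * Δ + 1 then some u else none)
    else (S.run (S.side p)).invoke t p
  deliver t q := if t ≤ 2 * Δ then S.early b t q else (messagesBefore n t).filter fun m =>
    t = S.late T m ∧ ∀ t' ≤ 2 * Δ, m ∉ S.early b t' q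

theorem mem_early {b : Bool} {t : ℕ} {q : Fin n} {m : Fin n × ℕ} (h : m ∈ S.early b t q) :
    t = (m.2 / Δ + 1) * Δ ∧ m.2 < t := by
  unfold early at h
  split_ifs at h
  · have := (S.synchronous b).of_mem_inbox (S.isRun b) h
    exact ⟨this.2.2.1, this.2.2.2.1⟩
  · have := (S.synchronous _).of_mem_inbox (S.isRun _) h
    exact ⟨this.2.2.1, this.2.2.2.1⟩
  · simp at h

theorem nodup_early (b : Bool) (t : ℕ) (q : Fin n) : (S.early b t q).Nodup := by
  unfold early
  split_ifs
  · exact (S.isRun b).nodup t q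
  · exact (S.isRun _).nodup t q
  · exact List.nodup_nil

theorem two_mul_lt_late (T : ℕ) (m : Fin n × ℕ) : 2 * Δ < S.late T m ∧ m.2 < S.late T m := by
  unfold late
  split_ifs <;> omega

theorem splice_isRun (c : Fin n) (u : V) (b : Bool) (K : Fin n → ℕ) (T : ℕ)
    (hK : ∀ p, K p ≤ 2 * Δ + 1) : ((S.splice c u b K T).run P).IsRun Δ := by
  have hΔ := S.pos
  apply Schedule.run_isRun
  · intro t p hp
    simp only [splice] at hp ⊢
    split_ifs with h
    · exact_mod_cast hp h
    · simp
  · intro t q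
    simp only [splice]
    split_ifs
    · exact S.nodup_early b t q
    · exact (nodup_messagesBefore n t).filter _
  · intro t t' q m h h'
    simp only [splice] at h h'
    split_ifs at h h' with h1 h2 h2
    · exact (S.mem_early h).1.trans (S.mem_early h').1.symm
    · rw [List.mem_filter, decide_eq_true_eq] at h'
      exact absurd h (h'.2.2 t h1)
    · rw [List.mem_filter, decide_eq_true_eq] at h
      exact absurd h' (h.2.2 t' h2)
    · rw [List.mem_filter, decide_eq_true_eq] at h h'
      exact h.2.1.trans h'.2.1.symm
  · intro p i j hi hj
    simp only [splice] at hi hj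
    split_ifs at hi hj with h1 h2 h3
    · exact h2.trans h3.symm
    all_goals first | exact ((S.solo _).eq_of_isSome hi hj).1 | simp_all
  -- Even the messages held back arrive by `max τ GST + 1` for this `GST`. Nothing is owed to a
  -- faulty destination, which crashes by time `2Δ + 1`.
  · refine ⟨max T (2 * Δ) + 1, ?_, ?_⟩
    · intro t p _ hp h
      have : (t : ℕ∞) < K p := by simpa [Schedule.run, splice, h] using hp
      exact_mod_cast this
    · intro τ s q hs _ hq
      have hqF : q ∉ S.spliceFaulty := by
        intro h
        have : ((max τ (max T (2 * Δ) + 1) + Δ : ℕ) : ℕ∞) < K q := by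
          simpa [Schedule.run, splice, h] using hq
        have : max τ (max T (2 * Δ) + 1) + Δ < K q := by exact_mod_cast this
        have := hK q
        omega
      by_cases he : ∃ t' ≤ 2 * Δ, (s, τ) ∈ S.early b t' q
      · obtain ⟨t', ht', h⟩ := he
        refine ⟨t', by omega, ?_⟩
        rw [Schedule.mem_run_inbox]
        exact ⟨fun h => (hqF h).elim, by simpa [splice, ht'] using h, (S.mem_early h).2, hs⟩
      · push Not at he
        have hl := S.two_mul_lt_late T (s, τ)
        refine ⟨S.late T (s, τ), ?_, ?_⟩
        · unfold late
          split_ifs <;> omega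
        · rw [Schedule.mem_run_inbox]
          refine ⟨fun h => (hqF h).elim, ?_, hl.2, hs⟩
          simp only [splice, if_neg (not_le.2 hl.1)]
          simpa using ⟨hl.2, he⟩

theorem splice_correct (c : Fin n) (u : V) (b : Bool) (K : Fin n → ℕ) (T : ℕ) (p : Fin n) :
    ((S.splice c u b K T).run P).Correct p ↔ p ∉ S.spliceFaulty := by
  simp only [Execution.Correct, Schedule.run, splice]
  split_ifs with h <;> simp [h]

theorem splice_ncard_faulty (c : Fin n) (u : V) (b : Bool) (K : Fin n → ℕ) (T : ℕ) :
    {p | ¬ ((S.splice c u b K T).run P).Correct p}.ncard = S.spliceFaulty.card := by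
  simp only [splice_correct, not_not]
  rw [show {p | p ∈ S.spliceFaulty} = (S.spliceFaulty : Set (Fin n)) from rfl,
    Set.ncard_coe_finset]

theorem splice_invoke (c : Fin n) (u : V) (b : Bool) (K : Fin n → ℕ) (T t : ℕ) (p : Fin n)
    (hp : p ∈ S.spliceFaulty → t < K p) : ((S.splice c u b K T).run P).invoke t p =
      if p = c then (if t = 2 * Δ + 1 then some u else none)
        else (S.run (S.side p)).invoke t p :=
  if_pos (c := (S.splice c u b K T).active t p) hp

open Classical in
theorem splice_inbox (c : Fin n) (u : V) (b : Bool) (K : Fin n → ℕ) (T t : ℕ) (q : Fin n)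
    (hq : q ∈ S.spliceFaulty → t < K q) : ((S.splice c u b K T).run P).inbox t q =
      if t ≤ 2 * Δ then (S.early b t q).filter fun m =>
        (((S.splice c u b K T).run P).sent m.2 m.1 q).isSome
      else (messagesBefore n t).filter fun m =>
        (((S.splice c u b K T).run P).sent m.2 m.1 q).isSome ∧
          t = S.late T m ∧ ∀ t' ≤ 2 * Δ, m ∉ S.early b t' q := by
  rw [Schedule.run_inbox, if_pos (by exact hq)]
  generalize ((S.splice c u b K T).run P).sent = g
  simp only [splice]
  split_ifs with h
  · exact List.filter_congr fun m hm => by simp [(S.mem_early hm).2]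
  · rw [List.filter_filter]
    refine List.filter_congr fun m hm => ?_
    rw [mem_messagesBefore] at hm
    simp [hm]

/-- In the spliced run, the proposer of the run `b` does not notice the difference by
time `2Δ`. -/
theorem splice_agree_run (c : Fin n) (u : V) (b : Bool) (K : Fin n → ℕ) (T : ℕ)
    (hc : c ∉ S.spliceFaulty) (hK : ∀ p, K p ≤ 2 * Δ + 1)
    (hKb : ∀ p ∉ S.faulty b, 2 * Δ < K p) (t : ℕ) (ht : t ≤ 2 * Δ) :
    ((S.splice c u b K T).run P).output t (S.proposer b) =
      (S.run b).output t (S.proposer b) := by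
  have hΔ := S.pos
  -- Only the proposer has to see its deliveries at `2Δ`; the others matter through the messages
  -- they send before.
  let R : ℕ → Fin n → Prop := fun t p =>
    p ∉ S.faulty b ∧ (t < 2 * Δ ∨ p = S.proposer b ∧ t = 2 * Δ)
  have hKR : ∀ t p, R t p → p ∈ S.spliceFaulty → t < K p := fun t p h _ =>
    lt_of_le_of_lt (by rcases h.2 with h | h <;> omega) (hKb p h.1)
  refine ((S.isRun b).agree (S.splice_isRun c u b K T hK) R ?_ ?_ ?_ ?_ ?_ t _
    ⟨S.proposer_notMem b, ?_⟩).2.2.symm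
  · exact fun t p h => ⟨h.1, by rcases h.2 with h | h <;> omega⟩
  · exact fun t p h => ⟨fun _ => hKR t p h, fun _ => (S.synchronous b).instantaneous t p h.1⟩
  · intro t p h
    rw [splice_invoke _ _ _ _ _ _ _ _ (hKR t p h)]
    have hne : p ≠ S.proposer (!b) := fun h' => by
      have := S.proposer_mem (!b)
      rw [← h', Bool.not_not] at this
      exact h.1 this
    by_cases hp : p = S.proposer b
    · have : p ≠ c := by
        rintro rfl
        apply hc
        rw [mem_spliceFaulty]
        cases b <;> simp_all
      rw [if_neg this, hp, side_proposer]
    -- Nobody but the two proposers calls in either solo run, and the call of `c` comes after `2Δ`.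
    · rw [(S.solo b).invoke_eq_none t hp]
      have hb : p ≠ S.proposer (S.side p) := by
        cases b <;> cases S.side p <;> simp_all
      rw [(S.solo _).invoke_eq_none t hb]
      have : t ≠ 2 * Δ + 1 := by rcases h.2 with h | h <;> omega
      simp [this]
  · intro t q h ih
    rw [splice_inbox _ _ _ _ _ _ _ _ (hKR t q h), if_pos (by rcases h.2 with h | h <;> omega)]
    have hearly : S.early b t q = (S.run b).inbox t q := by
      unfold early
      split_ifs with h1 h2
      · rfl
      · rw [S.side_eq h1 h.1]
      -- The region reaches time `2Δ` only at the proposer, which is faulty, so this case is void.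
      · obtain ⟨hq, -⟩ : q = S.proposer b ∧ t = 2 * Δ := h.2.resolve_left h2
        rw [mem_spliceFaulty] at h1
        cases b <;> simp_all
    rw [hearly, List.filter_eq_self.2]
    intro m hm
    obtain ⟨h1, h2, h3, h4, h5⟩ := (S.synchronous b).of_mem_inbox (S.isRun b) hm
    rw [← ih m.2 h4 m.1 ⟨h1, Or.inl (by rcases h.2 with h | h <;> omega)⟩]
    simpa using h5
  · intro t q h m hm
    obtain ⟨h1, h2, h3, h4, h5⟩ := (S.synchronous b).of_mem_inbox (S.isRun b) hm
    exact ⟨h1, Or.inl (by rcases h.2 with h | h <;> omega)⟩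
  · rcases ht.lt_or_eq with h | h
    · exact Or.inl h
    · exact Or.inr ⟨rfl, h⟩

/-- Synchronous deliveries occur only at positive multiples of `Δ`. Hence the first round of the
faulty processes does not depend on the run `b` they follow. -/
theorem early_eq_nil (b : Bool) {t : ℕ} (ht : t < Δ) (q : Fin n) : S.early b t q = [] := by
  rw [List.eq_nil_iff_forall_not_mem]
  intro m hm
  have h1 := (S.mem_early hm).1
  have : 1 * Δ ≤ (m.2 / Δ + 1) * Δ := Nat.mul_le_mul_right _ (Nat.le_add_left 1 _)
  omega

/-- In the spliced run, the correct processes do not notice before time `T` that the faulty ones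
have not crashed at time `Δ`. -/
theorem splice_agree (c : Fin n) (u : V) (b b' : Bool) (K : Fin n → ℕ) (T : ℕ)
    (hc : c ∉ S.spliceFaulty) (hK : ∀ p, K p ≤ 2 * Δ + 1) (hK' : ∀ p, Δ ≤ K p) (t : ℕ)
    (ht : t ≤ T) : ((S.splice c u b K T).run P).output t c =
      ((S.splice c u b' (fun _ => Δ) 0).run P).output t c := by
  have hΔ := S.pos
  -- Survivors are compared up to `T`, faulty processes only during the first round.
  let R : ℕ → Fin n → Prop := fun t p => t ≤ T ∧ (p ∈ S.spliceFaulty → t < Δ)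
  have hKR : ∀ t p, R t p → p ∈ S.spliceFaulty → t < K p := fun t p h hp =>
    (h.2 hp).trans_le (hK' p)
  have hx := S.splice_isRun c u b' (fun _ => Δ) 0 (fun _ => by omega)
  have hidle : ∀ t p q, p ∈ S.spliceFaulty → Δ ≤ t →
      ((S.splice c u b' (fun _ => Δ) 0).run P).sent t p q = none := fun t p q hp ht =>
    (hx.idle t p (fun h => absurd (show t < Δ from h hp) (by omega))).2.1 q
  have hearly : ∀ t q, R t q → S.early b t q = S.early b' t q := by
    intro t q h
    by_cases hq : q ∈ S.spliceFaulty
    · rw [S.early_eq_nil b (h.2 hq), S.early_eq_nil b' (h.2 hq)]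
    · simp [early, hq]
  refine (hx.agree (S.splice_isRun c u b K T hK) R ?_ ?_ ?_ ?_ ?_ t _
    ⟨ht, fun h => (hc h).elim⟩).2.2.symm
  · exact fun t p h => ⟨by have := h.1; omega, fun hp => by have := h.2 hp; omega⟩
  · exact fun t p h => ⟨fun _ => hKR t p h, fun _ => h.2⟩
  · intro t p h
    rw [splice_invoke _ _ _ _ _ _ _ _ (hKR t p h), splice_invoke _ _ _ _ _ _ _ _ h.2]
  · intro t q h ih
    rw [splice_inbox _ _ _ _ _ _ _ _ (hKR t q h), splice_inbox _ _ _ _ _ _ _ _ h.2]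
    split_ifs with h2
    · rw [hearly t q h]
      refine List.filter_congr fun m hm => ?_
      obtain ⟨h3, h4⟩ := S.mem_early hm
      -- Early deliveries to survivors occur before `2Δ`, so they carry first-round messages only.
      have hm2 : m.2 < Δ := by
        by_cases hq : q ∈ S.spliceFaulty
        · have := h.2 hq; omega
        · simp only [early, hq, if_false] at hm
          split_ifs at hm with h5
          · have : m.2 / Δ < 1 := by
              by_contra h6
              have : 2 * Δ ≤ (m.2 / Δ + 1) * Δ := Nat.mul_le_mul_right _ (by omega)
              omega
            rwa [Nat.div_lt_iff_lt_mul hΔ, one_mul] at this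
          · simp at hm
      rw [ih m.2 h4 m.1 ⟨by have := h.1; omega, fun _ => hm2⟩]
    · have hq : q ∉ S.spliceFaulty := fun hq => by have := h.2 hq; omega
      refine List.filter_congr fun m hm => ?_
      rw [mem_messagesBefore] at hm
      by_cases hs : m.1 ∈ S.spliceFaulty → m.2 < Δ
      · rw [ih m.2 hm m.1 ⟨by have := h.1; omega, hs⟩]
        have : m.1 ∉ S.spliceFaulty ∨ m.2 < Δ := by tauto
        simp [late, this, early, hq]
      -- A message sent by a faulty process from time `Δ` on does not exist in the reference run,
      -- and arrives after `T` in the other.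
      · push Not at hs
        rw [hidle _ _ _ hs.1 hs.2]
        have : t ≠ S.late T m := by
          have : ¬ (m.1 ∉ S.spliceFaulty ∨ m.2 < Δ) := by push Not; exact hs
          rw [late, if_neg this]
          have := h.1
          omega
        simp [this]
  · intro t q h m hm
    obtain ⟨-, -, h3, h4⟩ := (Schedule.mem_run_inbox _ _).1 hm
    refine ⟨by have := h.1; omega, fun hs => ?_⟩
    by_contra hlt
    simp [hidle m.2 m.1 q hs (not_lt.1 hlt)] at h4

/-- The value returned to the late caller `c` is fixed by a reference run. It is then compared, in
two runs that `c` cannot tell from it, with the fast decision of either proposer. -/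
theorem value_eq {e f : ℕ} (hP : P.Resilient Δ f) (hef : e ≤ f)
    (hcard : ∀ b, (S.faulty b).card = e) (htwo : ∀ b, (S.run b).TwoStepFor Δ (S.proposer b))
    (hF : S.spliceFaulty.card ≤ f) (hfn : f < n) : S.value false = S.value true := by
  have hΔ := S.pos
  obtain ⟨c, hc⟩ : ∃ c, c ∉ S.spliceFaulty := by
    by_contra h
    push Not at h
    rw [Finset.eq_univ_of_forall h, Finset.card_univ, Fintype.card_fin] at hF
    omega
  let u := S.value false
  -- In the reference run all faulty processes crash at time `Δ`; the choice of `true` is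
  -- immaterial.
  obtain ⟨T, w, hT⟩ := (hP _ (S.splice_isRun c u true (fun _ => Δ) 0 (fun _ => by omega))
    ((S.splice_ncard_faulty ..).trans_le hF)).2 c (2 * Δ + 1) ((S.splice_correct ..).2 hc)
    (by simp [S.splice_invoke c u true _ 0 _ c (fun h => (hc h).elim)])
  have key : ∀ b, w = S.value b := by
    intro b
    -- Faulty processes alive in run `b` last through time `2Δ`; the other proposer stops after the
    -- first round.
    let K : Fin n → ℕ := fun p => if p ∈ S.faulty b then Δ else 2 * Δ + 1
    have hK : ∀ p, K p ≤ 2 * Δ + 1 := fun p => by simp only [K]; split_ifs <;> omega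
    have hK' : ∀ p, Δ ≤ K p := fun p => by simp only [K]; split_ifs <;> omega
    have hρ := (hP _ (S.splice_isRun c u b K T hK)
      ((S.splice_ncard_faulty ..).trans_le hF)).1
    have h1 := S.splice_agree c u b true K T hc hK hK' T le_rfl
    rw [hT.2.2.1] at h1
    obtain ⟨t, z, ht, hz⟩ := htwo b
    have h2 := S.splice_agree_run c u b K T hc hK
      (fun p hp => by simp only [K, if_neg hp]; omega) t ht
    rw [hz] at h2
    -- The solo run has `e ≤ f` faults, so validity identifies the value decided there.
    have hσ := (hP _ (S.isRun b) (by
      rw [← hcard b] at hef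
      refine le_trans ?_ hef
      rw [← Set.ncard_coe_finset]
      refine Set.ncard_le_ncard (fun p hp => ?_) (Finset.finite_toSet _)
      by_contra h
      exact hp ((S.synchronous b).correct p h))).1
    have hv : z = S.value b := hσ.output_eq_of_invoke (fun i q v' hv' => by
      obtain ⟨k, hk1, hk2⟩ := S.solo b
      by_cases h : (i, q) = (k, S.proposer b)
      · obtain ⟨rfl, rfl⟩ := Prod.mk.inj h
        simpa [hk1] using hv'.symm
      · simp [hk2 i q h] at hv') hz
    exact (hρ.output_eq h1 h2).trans hv
  exact (key false).symm.trans (key true)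

end SoloPair

theorem Protocol.Resilient.le_of_twoStep {n e f Δ : ℕ} {V : Type u} [Nontrivial V] (hef : e ≤ f)
    (hΔ : 0 < Δ) {P : Protocol n V} (hP : P.Resilient Δ f) (hT : P.TwoStep Δ e)
    (hf : 2 * f + 1 ≤ n) : 2 * e + f - 1 ≤ n := by
  by_contra hlt
  obtain ⟨v, w, hvw⟩ := exists_pair_ne V
  -- The last and the first `e` processes; they are disjoint since `2e ≤ 2f < n`. Each proposer lies
  -- in the set that crashes in the other run.
  let E : Bool → Finset (Fin n) := fun b =>
    if b then Finset.univ.filter fun i => i.1 < e else Finset.univ.filter fun i => n ≤ i.1 + e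
  let pr : Bool → Fin n := fun b => if b then ⟨n - 1, by omega⟩ else ⟨0, by omega⟩
  let val : Bool → V := fun b => if b then w else v
  have hE : ∀ b, (E b).card = e := by
    rintro (_ | _)
    · have : E false = Finset.Ici ⟨n - e, by omega⟩ := by
        ext i; simp [E, Fin.le_def]
      rw [this, Fin.card_Ici]
      simp only
      omega
    · have : E true = Finset.Iio ⟨e, by omega⟩ := by
        ext i; simp [E, Fin.lt_def]
      rw [this, Fin.card_Iio]
  have hpr : ∀ b, pr b ∉ E b := by
    rintro (_ | _) <;> simp [E, pr] <;> omega
  have hex : ∀ b, ∃ x : Execution P, x.IsRun Δ ∧ x.FaultySynchronous Δ (E b) ∧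
      x.SoloProposal (pr b) (val b) ∧ x.TwoStepFor Δ (pr b) :=
    fun b => (hT (E b) (hE b) (val b) (pr b) (hpr b)).1
  choose x h1 h2 h3 h4 using hex
  let S : SoloPair P Δ :=
    { run := x, faulty := E, proposer := pr, value := val, isRun := h1, synchronous := h2,
      solo := h3, proposer_notMem := hpr, pos := hΔ
      proposer_mem := by rintro (_ | _) <;> simp [E, pr] <;> omega }
  refine hvw (S.value_eq hP hef hE h4 ?_ (by omega))
  -- At most `2 + (n - 2e)` faulty processes, which is at most `f` exactly because the bound is
  -- violated.
  have hsub : S.spliceFaulty ⊆ {pr false, pr true} ∪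
      (Finset.Ico e (n - e)).attachFin (fun i hi => by simp at hi; omega) := by
    intro i hi
    rw [SoloPair.mem_spliceFaulty] at hi
    simp only [Finset.mem_union, Finset.mem_insert, Finset.mem_singleton,
      Finset.mem_attachFin, Finset.mem_Ico]
    rcases hi with h | h | ⟨h5, h6⟩
    · exact Or.inl (Or.inl h)
    · exact Or.inl (Or.inr h)
    · right
      simp only [S, E, Finset.mem_filter, Finset.mem_univ, true_and, if_true, if_false,
        Bool.false_eq_true] at h5 h6
      omega
  refine (Finset.card_le_card hsub).trans ((Finset.card_union_le _ _).trans ?_)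
  have := Finset.card_le_two (a := pr false) (b := pr true)
  rw [Finset.card_attachFin, Nat.card_Ico]
  omega

/-! ### A two-step protocol -/

namespace FastConsensus

/-- The part of the local state that a process broadcasts at each step. -/
structure Snapshot (n : ℕ) (V : Type u) where
  /-- the ballot joined; ballot `0` is the fast one -/
  ballot : ℕ
  /-- the value proposed in the current ballot, if the process owns it -/
  proposal : Option V
  /-- the last vote in a slow ballot -/
  vote : Option (ℕ × V)
  /-- the value proposed by the process in the fast ballot -/
  input : Option V
  /-- the vote in the fast ballot: the process voted for and its input -/
  fastVote : Option (Fin n × V)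
  /-- the value decided by the process in the fast ballot as a proposer -/
  fast : Option V
  /-- some value passed to `propose` -/
  candidate : Option V

structure LocalState (n : ℕ) (V : Type u) where
  snap : Snapshot n V
  /-- the number of steps taken -/
  clock : ℕ
  /-- the time on the local clock at which another process was last heard from -/
  heard : Fin n → ℕ
  /-- all snapshots received, with their senders -/
  log : List (Fin n × Snapshot n V)
  /-- there is a pending call -/
  pending : Prop
  decision : Option V

variable {n : ℕ} {V : Type u}

/-- Process `p` owns the slow ballot `b`. -/
def Owns (p : Fin n) (b : ℕ) : Prop := b ≠ 0 ∧ b % n = p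

/-! ### The transition function -/

section Step

open Classical

variable (e f Δ : ℕ) (p : Fin n) (s : Snapshot n V) (log : List (Fin n × Snapshot n V))

/-- A process that has already cast its fast vote does not become a proposer of ballot `0`. Hence
its vote never contradicts its input. -/
noncomputable def nextInput (inv : Option V) : Option V :=
  if s.input = none ∧ s.fastVote = none then inv else s.input

noncomputable def nextCandidate (inv : Option V) : Option V :=
  (s.candidate.or inv).or (log.findSome? fun m => m.2.candidate)

def maxBallot : ℕ := log.foldr (fun m b => max m.2.ballot b) s.ballot

/-- A new ballot is congruent to `p` modulo `n` and exceeds all known ones. A leader keeps a ballot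
it already owns, which lets ballots stabilize. -/
noncomputable def nextBallot (leader : Prop) : ℕ :=
  if leader ∧ ¬ Owns p (maxBallot s log) then (maxBallot s log + 1) * n + p else maxBallot s log

/-- The processes known to have joined ballot `b`. -/
noncomputable def joined (b : ℕ) : Finset (Fin n) :=
  Finset.univ.filter fun q => ∃ m, (q, m) ∈ log ∧ m.ballot = b

/-- The processes that have joined ballot `b`, known to have voted for the pair `a` in the fast
ballot. -/
noncomputable def supporters (b : ℕ) (a : Fin n × V) : Finset (Fin n) :=
  Finset.univ.filter fun q => ∃ m, (q, m) ∈ log ∧ m.ballot = b ∧ m.fastVote = some a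

/-- `a` is a vote in the highest slow ballot, among the votes of the processes that have joined
ballot `b`. -/
def IsLatestVote (b : ℕ) (a : ℕ × V) : Prop :=
  (∃ m ∈ log, m.2.ballot = b ∧ m.2.vote = some a) ∧
    ∀ m ∈ log, m.2.ballot = b → ∀ a', m.2.vote = some a' → a'.1 ≤ a.1

/-- `a` has the most votes in the fast ballot, among the processes that have joined ballot `b`,
and disregarding the proposers that have joined ballot `b`. -/
def IsMostSupported (b : ℕ) (a : Fin n × V) : Prop :=
  a.1 ∉ joined log b ∧ (supporters log b a).Nonempty ∧
    ∀ a' : Fin n × V, a'.1 ∉ joined log b →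
      (supporters log b a').card ≤ (supporters log b a).card

/-- The value to be proposed in ballot `b`. -/
noncomputable def pick (b : ℕ) (candidate : Option V) : Option V :=
  if h : ∃ v, ∃ m ∈ log, m.2.fast = some v then some h.choose
  else if h : ∃ a, IsLatestVote log b a then some h.choose.2
  else if h : ∃ a, IsMostSupported log b a then some h.choose.2
  else candidate

/-- The proposal is kept while the ballot lasts, so a ballot never carries two values. -/
noncomputable def nextProposal (b : ℕ) (candidate : Option V) : Option V :=
  if b = s.ballot ∧ s.proposal.isSome then s.proposal
  else if Owns p b ∧ n - f ≤ (joined log b).card then pick log b candidate else none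

/-- No vote is cast outside ballot `0`, so that reports made in slow ballots are final. The same
holds for `nextFast`. -/
noncomputable def nextFastVote (b : ℕ) (input : Option V) : Option (Fin n × V) :=
  if s.fastVote = none ∧ b = 0 then
    log.findSome? fun m => (m.2.input.filter fun v => input = none ∨ input = some v).map
      fun v => (m.1, v)
  else s.fastVote

/-- The owner of ballot `b` has proposed `v` in it. -/
def Proposed (b : ℕ) (v : V) : Prop :=
  ∃ m ∈ log, Owns m.1 b ∧ m.2.ballot = b ∧ m.2.proposal = some v

noncomputable def nextVote (b : ℕ) : Option (ℕ × V) :=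
  if h : ∃ v, Proposed log b v then some (b, h.choose) else s.vote

/-- The processes known to have voted for the input `v` of `p` in the fast ballot, and `p`. -/
noncomputable def fastVoters (v : V) : Finset (Fin n) :=
  insert p (Finset.univ.filter fun q => ∃ m, (q, m) ∈ log ∧ m.fastVote = some (p, v))

noncomputable def nextFast (b : ℕ) (input : Option V) : Option V :=
  if s.fast = none ∧ b = 0 then
    input.filter fun v => n - e ≤ (fastVoters p log v).card
  else s.fast

/-- The processes known to have voted for `v` in ballot `b`. -/
noncomputable def voters (b : ℕ) (v : V) : Finset (Fin n) :=
  Finset.univ.filter fun q => ∃ m, (q, m) ∈ log ∧ m.vote = some (b, v)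

noncomputable def nextDecision (d fast : Option V) : Option V :=
  d.or (fast.or (if h : ∃ v, ∃ b, n - f ≤ (voters log b v).card then some h.choose else none))

noncomputable def nextSnapshot (leader : Prop) (inv : Option V) : Snapshot n V where
  ballot := nextBallot p s log leader
  proposal := nextProposal f p s log (nextBallot p s log leader) (nextCandidate s log inv)
  vote := nextVote s log (nextBallot p s log leader)
  input := nextInput s inv
  fastVote := nextFastVote s log (nextBallot p s log leader) (nextInput s inv)
  fast := nextFast e p s log (nextBallot p s log leader) (nextInput s inv)
  candidate := nextCandidate s log inv

noncomputable def nextHeard (st : LocalState n V) (msgs : List (Fin n × Snapshot n V))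
    (q : Fin n) : ℕ :=
  if ∃ m ∈ msgs, m.1 = q then st.clock else st.heard q

/-- The initial wait keeps slow ballots away until `2Δ`. The clock counts steps, hence advances with
real time at a correct process from `GST` on. -/
def IsLeader (st : LocalState n V) (msgs : List (Fin n × Snapshot n V)) : Prop :=
  2 * Δ < st.clock ∧ ∀ q < p, nextHeard st msgs q + Δ < st.clock

noncomputable def nextState (st : LocalState n V) (inv : Option V)
    (msgs : List (Fin n × Snapshot n V)) : LocalState n V where
  snap := nextSnapshot e f p st.snap (st.log ++ msgs) (IsLeader Δ p st msgs) inv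
  clock := st.clock + 1
  heard := nextHeard st msgs
  log := st.log ++ msgs
  pending := (st.pending ∨ inv.isSome) ∧ nextDecision f (st.log ++ msgs) st.decision
    (nextSnapshot e f p st.snap (st.log ++ msgs) (IsLeader Δ p st msgs) inv).fast = none
  decision := nextDecision f (st.log ++ msgs) st.decision
    (nextSnapshot e f p st.snap (st.log ++ msgs) (IsLeader Δ p st msgs) inv).fast

end Step

open Classical in
/-- Fast Paxos with a rotating sequence of slow ballots, in which each process broadcasts its
snapshot at each step. -/
noncomputable abbrev protocol (n : ℕ) (V : Type u) (e f Δ : ℕ) : Protocol n V where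
  State := LocalState n V
  Msg := Snapshot n V
  init _ :=
    { snap := ⟨0, none, none, none, none, none, none⟩, clock := 0, heard := fun _ => 0, log := [],
      pending := False, decision := none }
  step p st inv msgs :=
    (nextState e f Δ p st inv msgs, fun _ => some (nextState e f Δ p st inv msgs).snap,
      if st.pending ∨ inv.isSome then (nextState e f Δ p st inv msgs).decision else none)

/-! #### Basic properties of the runs -/

section Run

variable {e f Δ : ℕ} {x : Execution (protocol n V e f Δ)}

/-- The snapshot of `p` just before time `t`. -/
abbrev snapAt (x : Execution (protocol n V e f Δ)) (t : ℕ) (p : Fin n) : Snapshot n V :=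
  LocalState.snap (x.state t p)

abbrev logAt (x : Execution (protocol n V e f Δ)) (t : ℕ) (p : Fin n) :
    List (Fin n × Snapshot n V) :=
  LocalState.log (x.state t p)

abbrev decisionAt (x : Execution (protocol n V e f Δ)) (t : ℕ) (p : Fin n) : Option V :=
  LocalState.decision (x.state t p)

theorem state_succ (hx : x.IsRun Δ) {t : ℕ} {p : Fin n} (h : x.active t p) :
    x.state (t + 1) p = nextState e f Δ p (x.state t p) (x.invoke t p) (x.received t p) :=
  (Prod.mk.inj (hx.step t p h)).1

theorem sent_eq (hx : x.IsRun Δ) {t : ℕ} {p : Fin n} (h : x.active t p) (q : Fin n) :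
    x.sent t p q = some (snapAt x (t + 1) p) := by
  have h1 := hx.step t p h
  simp only [Prod.mk.injEq] at h1
  rw [h1.2.1, snapAt, state_succ hx h]

theorem active_of_sent (hx : x.IsRun Δ) {t : ℕ} {p q : Fin n} (h : (x.sent t p q).isSome) :
    x.active t p := by
  by_contra hp
  simp [(hx.idle t p hp).2.1 q] at h

open Classical in
theorem output_eq (hx : x.IsRun Δ) {t : ℕ} {p : Fin n} (h : x.active t p) :
    x.output t p = if LocalState.pending (x.state t p) ∨ (x.invoke t p).isSome then
      decisionAt x (t + 1) p else none := by
  have h1 := hx.step t p h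
  simp only [Prod.mk.injEq] at h1
  rw [h1.2.2, decisionAt, state_succ hx h]

theorem state_idle (hx : x.IsRun Δ) {t : ℕ} {p : Fin n} (h : ¬ x.active t p) :
    x.state (t + 1) p = x.state t p := (hx.idle t p h).1

/-- The leader condition at a step. -/
def leaderAt (x : Execution (protocol n V e f Δ)) (t : ℕ) (p : Fin n) : Prop :=
  IsLeader Δ p (x.state t p) (x.received t p)

theorem snapAt_succ (hx : x.IsRun Δ) {t : ℕ} {p : Fin n} (h : x.active t p) :
    snapAt x (t + 1) p = nextSnapshot e f p (snapAt x t p) (logAt x (t + 1) p)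
      (leaderAt x t p) (x.invoke t p) := by
  rw [snapAt, logAt, state_succ hx h]
  rfl

theorem decisionAt_succ (hx : x.IsRun Δ) {t : ℕ} {p : Fin n} (h : x.active t p) :
    decisionAt x (t + 1) p = nextDecision f (logAt x (t + 1) p) (decisionAt x t p)
      (snapAt x (t + 1) p).fast := by
  rw [decisionAt, logAt, snapAt, state_succ hx h]
  rfl

theorem logAt_succ (hx : x.IsRun Δ) {t : ℕ} {p : Fin n} (h : x.active t p) :
    logAt x (t + 1) p = logAt x t p ++ x.received t p := by
  rw [logAt, state_succ hx h]
  rfl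

theorem mem_received (hx : x.IsRun Δ) {t : ℕ} {p q : Fin n} {m : Snapshot n V} :
    (q, m) ∈ x.received t p ↔ ∃ τ, (q, τ) ∈ x.inbox t p ∧ m = snapAt x (τ + 1) q := by
  unfold Execution.received
  rw [List.mem_filterMap]
  constructor
  · rintro ⟨⟨s, τ⟩, h, h'⟩
    have hact := active_of_sent hx (hx.no_creation t p s τ h).2
    simp only [sent_eq hx hact, Option.map_some, Option.some.injEq, Prod.mk.injEq] at h'
    obtain ⟨rfl, rfl⟩ := h'
    exact ⟨τ, h, rfl⟩
  · rintro ⟨τ, h, rfl⟩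
    have hact := active_of_sent hx (hx.no_creation t p q τ h).2
    exact ⟨(q, τ), h, by simp only [sent_eq hx hact]; rfl⟩

theorem logAt_mono (hx : x.IsRun Δ) {t t' : ℕ} (htt : t ≤ t') (p : Fin n) :
    ∀ m ∈ logAt x t p, m ∈ logAt x t' p := by
  induction t', htt using Nat.le_induction with
  | base => exact fun m hm => hm
  | succ t' _ ih =>
    intro m hm
    by_cases h : x.active t' p
    · rw [logAt_succ hx h]
      exact List.mem_append_left _ (ih m hm)
    · rw [logAt, state_idle hx h]
      exact ih m hm

/-- The strict inequality is what the inductions on time rely on. -/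
theorem exists_of_mem_logAt (hx : x.IsRun Δ) {t : ℕ} {p q : Fin n} {m : Snapshot n V}
    (h : (q, m) ∈ logAt x t p) : ∃ t' < t, m = snapAt x t' q := by
  induction t with
  | zero => rw [logAt, hx.start] at h; simp at h
  | succ t ih =>
    by_cases ha : x.active t p
    · rw [logAt_succ hx ha, List.mem_append] at h
      rcases h with h | h
      · obtain ⟨t', h1, h2⟩ := ih h
        exact ⟨t', by omega, h2⟩
      · obtain ⟨τ, h1, h2⟩ := (mem_received hx).1 h
        have := (hx.no_creation _ _ _ _ h1).1
        exact ⟨τ + 1, by omega, h2⟩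
    · rw [logAt, state_idle hx ha] at h
      obtain ⟨t', h1, h2⟩ := ih h
      exact ⟨t', by omega, h2⟩

/-- Induction along the states of a process. -/
theorem snapAt_induction (hx : x.IsRun Δ) {p : Fin n} (Q : ℕ → Snapshot n V → Prop) {t₀ : ℕ}
    (h₀ : Q t₀ (snapAt x t₀ p)) (hidle : ∀ t s, t₀ ≤ t → Q t s → Q (t + 1) s)
    (hstep : ∀ t, t₀ ≤ t → x.active t p → Q t (snapAt x t p) →
      Q (t + 1) (nextSnapshot e f p (snapAt x t p) (logAt x (t + 1) p) (leaderAt x t p)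
        (x.invoke t p))) {t : ℕ} (ht : t₀ ≤ t) : Q t (snapAt x t p) := by
  induction t, ht using Nat.le_induction with
  | base => exact h₀
  | succ t ht ih =>
    by_cases h : x.active t p
    · rw [snapAt_succ hx h]
      exact hstep t ht h ih
    · rw [snapAt, state_idle hx h]
      exact hidle t _ ht ih

theorem snapAt_zero (hx : x.IsRun Δ) (p : Fin n) :
    snapAt x 0 p = ⟨0, none, none, none, none, none, none⟩ := by
  rw [snapAt, hx.start]

end Run

end FastConsensus

/-! #### Safety -/

namespace FastConsensus

variable {n : ℕ} {V : Type u} {e f Δ : ℕ}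

/-! ### Properties of a single transition -/

section Next

variable {p : Fin n} {s : Snapshot n V} {log : List (Fin n × Snapshot n V)}

theorem le_maxBallot : s.ballot ≤ maxBallot s log := by
  unfold maxBallot
  induction log with
  | nil => exact le_rfl
  | cons m log ih => exact ih.trans (le_max_right _ _)

theorem ballot_le_maxBallot {m : Fin n × Snapshot n V} (hm : m ∈ log) :
    m.2.ballot ≤ maxBallot s log := by
  unfold maxBallot
  induction log with
  | nil => simp at hm
  | cons m' log ih =>
    rcases List.mem_cons.1 hm with rfl | hm
    · exact le_max_left _ _
    · exact (ih hm).trans (le_max_right _ _)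

theorem maxBallot_le {b : ℕ} (hs : s.ballot ≤ b) (hlog : ∀ m ∈ log, m.2.ballot ≤ b) :
    maxBallot s log ≤ b := by
  unfold maxBallot
  induction log with
  | nil => exact hs
  | cons m' log ih =>
    exact max_le (hlog m' (by simp)) (ih fun m hm => hlog m (by simp [hm]))

theorem maxBallot_le_nextBallot {l : Prop} : maxBallot s log ≤ nextBallot p s log l := by
  unfold nextBallot
  split_ifs
  · have : 1 ≤ n := by have := p.2; omega
    nlinarith [Nat.zero_le (maxBallot s log), Nat.zero_le p.1]
  · exact le_rfl

theorem ballot_le_nextBallot {l : Prop} : s.ballot ≤ nextBallot p s log l :=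
  le_maxBallot.trans maxBallot_le_nextBallot

theorem nextBallot_owns {l : Prop} (hl : l) : Owns p (nextBallot p s log l) := by
  unfold nextBallot
  split_ifs with h
  · refine ⟨?_, ?_⟩
    · have : 1 ≤ n := by have := p.2; omega
      positivity
    · rw [mul_comm, Nat.mul_add_mod, Nat.mod_eq_of_lt p.2]
  · simpa [hl] using h

theorem nextBallot_eq {l : Prop} (hl : ¬ l) : nextBallot p s log l = maxBallot s log :=
  if_neg fun h => hl h.1

theorem mem_joined {b : ℕ} {q : Fin n} :
    q ∈ joined log b ↔ ∃ m, (q, m) ∈ log ∧ m.ballot = b := by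
  simp [joined]

theorem mem_supporters {b : ℕ} {a : Fin n × V} {q : Fin n} :
    q ∈ supporters log b a ↔ ∃ m, (q, m) ∈ log ∧ m.ballot = b ∧ m.fastVote = some a := by
  simp [supporters]

theorem mem_voters {b : ℕ} {v : V} {q : Fin n} :
    q ∈ voters log b v ↔ ∃ m, (q, m) ∈ log ∧ m.vote = some (b, v) := by
  simp [voters]

theorem mem_fastVoters {v : V} {q : Fin n} : q ∈ fastVoters p log v ↔
    q = p ∨ ∃ m, (q, m) ∈ log ∧ m.fastVote = some (p, v) := by
  simp [fastVoters]

theorem supporters_subset_joined (b : ℕ) (a : Fin n × V) :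
    supporters log b a ⊆ joined log b := by
  intro q hq
  obtain ⟨m, h1, h2, -⟩ := mem_supporters.1 hq
  exact mem_joined.2 ⟨m, h1, h2⟩

theorem exists_isLatestVote {b : ℕ} {m : Fin n × Snapshot n V} (hm : m ∈ log)
    (hb : m.2.ballot = b) {a : ℕ × V} (ha : m.2.vote = some a) : ∃ a, IsLatestVote log b a := by
  let S : Set ℕ := {k | ∃ m ∈ log, m.2.ballot = b ∧ ∃ v, m.2.vote = some (k, v)}
  have hfin : S.Finite := by
    refine (List.finite_toSet (log.map fun m => (m.2.vote.map Prod.fst).getD 0)).subset ?_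
    rintro k ⟨m, hm, -, v, hv⟩
    exact List.mem_map.2 ⟨m, hm, by simp [hv]⟩
  obtain ⟨k, ⟨m', hm', hb', v, hv⟩, hmax⟩ :=
    hfin.exists_maximalFor id S ⟨a.1, m, hm, hb, a.2, ha⟩
  refine ⟨(k, v), ⟨m', hm', hb', hv⟩, fun m'' hm'' hb'' a' ha' => ?_⟩
  by_contra hlt
  have := hmax (j := a'.1) ⟨m'', hm'', hb'', a'.2, ha'⟩ (by simp at hlt ⊢; omega)
  simp at this hlt
  omega

theorem exists_isMostSupported {b : ℕ} {a : Fin n × V} (ha : a.1 ∉ joined log b)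
    (hne : (supporters log b a).Nonempty) : ∃ a, IsMostSupported log b a := by
  let S : Set ℕ := {k | ∃ a : Fin n × V, a.1 ∉ joined log b ∧ (supporters log b a).card = k}
  have hfin : S.Finite := by
    refine (Set.finite_Iic n).subset ?_
    rintro k ⟨a, -, rfl⟩
    simpa using Finset.card_le_univ (supporters log b a)
  obtain ⟨k, ⟨a', ha', hk⟩, hmax⟩ := hfin.exists_maximalFor id S ⟨_, a, ha, rfl⟩
  have hle : ∀ a'' : Fin n × V, a''.1 ∉ joined log b → (supporters log b a'').card ≤ k := by
    intro a'' ha''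
    by_contra hlt
    have := hmax (j := (supporters log b a'').card) ⟨a'', ha'', rfl⟩ (by simp at hlt ⊢; omega)
    simp at this hlt
    omega
  refine ⟨a', ha', ?_, fun a'' h => hk ▸ hle a'' h⟩
  rw [← Finset.card_pos, hk]
  exact (Finset.card_pos.2 hne).trans_le (hle a ha)

theorem pick_spec {b : ℕ} {c : Option V} {w : V} (h : pick log b c = some w) :
    (∃ m ∈ log, m.2.fast = some w) ∨
    (¬ (∃ v, ∃ m ∈ log, m.2.fast = some v) ∧ ((∃ k, IsLatestVote log b (k, w)) ∨
    (¬ (∃ a, IsLatestVote log b a) ∧ ((∃ q, IsMostSupported log b (q, w)) ∨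
    (¬ (∃ a, IsMostSupported log b a) ∧ c = some w))))) := by
  unfold pick at h
  split_ifs at h with h1 h2 h3
  · left
    obtain rfl := Option.some.inj h
    exact h1.choose_spec
  · refine Or.inr ⟨h1, Or.inl ?_⟩
    obtain rfl := Option.some.inj h
    exact ⟨_, h2.choose_spec⟩
  · refine Or.inr ⟨h1, Or.inr ⟨h2, Or.inl ?_⟩⟩
    obtain rfl := Option.some.inj h
    exact ⟨_, h3.choose_spec⟩
  · exact Or.inr ⟨h1, Or.inr ⟨h2, Or.inr ⟨h3, h⟩⟩⟩

theorem nextProposal_spec {b : ℕ} {c : Option V} {w : V}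
    (h : nextProposal f p s log b c = some w) :
    (b = s.ballot ∧ s.proposal = some w) ∨ (¬ (b = s.ballot ∧ s.proposal.isSome) ∧ Owns p b ∧
      n - f ≤ (joined log b).card ∧ pick log b c = some w) := by
  unfold nextProposal at h
  split_ifs at h with h1 h2
  · exact Or.inl ⟨h1.1, h⟩
  · exact Or.inr ⟨h1, h2.1, h2.2, h⟩

theorem nextFastVote_spec {b : ℕ} {i : Option V} {a : Fin n × V}
    (h : nextFastVote s log b i = some a) : s.fastVote = some a ∨
      (s.fastVote = none ∧ b = 0 ∧ (i = none ∨ i = some a.2) ∧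
        ∃ m, (a.1, m) ∈ log ∧ m.input = some a.2) := by
  unfold nextFastVote at h
  split_ifs at h with h1
  · right
    obtain ⟨m, hm, h2⟩ := List.exists_of_findSome?_eq_some h
    simp only [Option.map_eq_some_iff, Option.filter_eq_some_iff, decide_eq_true_eq] at h2
    obtain ⟨v, ⟨h3, h4⟩, rfl⟩ := h2
    exact ⟨h1.1, h1.2, h4, m.2, hm, h3⟩
  · exact Or.inl h

theorem nextFastVote_of_some {b : ℕ} {i : Option V} {a : Fin n × V} (h : s.fastVote = some a) :
    nextFastVote s log b i = some a := by
  simp [nextFastVote, h]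

theorem nextFastVote_of_ne_zero {b : ℕ} {i : Option V} (h : b ≠ 0) :
    nextFastVote s log b i = s.fastVote := by
  simp [nextFastVote, h]

theorem nextVote_spec {b : ℕ} {a : ℕ × V} (h : nextVote s log b = some a) :
    s.vote = some a ∨ (a.1 = b ∧ Proposed log b a.2) := by
  unfold nextVote at h
  split_ifs at h with h1
  · obtain rfl := Option.some.inj h
    exact Or.inr ⟨rfl, h1.choose_spec⟩
  · exact Or.inl h

theorem nextVote_isSome {b k : ℕ} {v : V} (h : s.vote = some (k, v)) (hk : k ≤ b) :
    ∃ k' v', nextVote s log b = some (k', v') ∧ k ≤ k' := by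
  unfold nextVote
  split_ifs with h1
  · exact ⟨b, _, rfl, hk⟩
  · exact ⟨k, v, h, le_rfl⟩

theorem nextFast_spec {b : ℕ} {i : Option V} {v : V} (h : nextFast e p s log b i = some v) :
    s.fast = some v ∨ (b = 0 ∧ i = some v ∧ n - e ≤ (fastVoters p log v).card) := by
  unfold nextFast at h
  split_ifs at h with h1
  · rw [Option.filter_eq_some_iff] at h
    exact Or.inr ⟨h1.2, h.1, by simpa using h.2⟩
  · exact Or.inl h

theorem nextFast_of_some {b : ℕ} {i : Option V} {v : V} (h : s.fast = some v) :
    nextFast e p s log b i = some v := by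
  simp [nextFast, h]

theorem nextFast_of_ne_zero {b : ℕ} {i : Option V} (h : b ≠ 0) :
    nextFast e p s log b i = s.fast := by
  simp [nextFast, h]

theorem nextInput_of_some {i : Option V} {v : V} (h : s.input = some v) :
    nextInput s i = some v := by
  simp [nextInput, h]

theorem nextDecision_spec {d c : Option V} {w : V} (h : nextDecision f log d c = some w) :
    d = some w ∨ c = some w ∨ ∃ b, n - f ≤ (voters log b w).card := by
  unfold nextDecision at h
  rw [Option.or_eq_some_iff, Option.or_eq_some_iff] at h
  rcases h with h | ⟨-, h | ⟨-, h⟩⟩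
  · exact Or.inl h
  · exact Or.inr (Or.inl h)
  · split_ifs at h with h1
    obtain rfl := Option.some.inj h
    exact Or.inr (Or.inr h1.choose_spec)

end Next

/-! ### Invariants of the fast and the slow ballots -/

section Run

variable {x : Execution (protocol n V e f Δ)}

theorem ballot_mono (hx : x.IsRun Δ) (p : Fin n) {t t' : ℕ} (h : t ≤ t') :
    (snapAt x t p).ballot ≤ (snapAt x t' p).ballot :=
  snapAt_induction hx (fun _ s => (snapAt x t p).ballot ≤ s.ballot) le_rfl
    (fun _ _ _ h => h) (fun _ _ _ h => h.trans ballot_le_nextBallot) h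

theorem input_mono (hx : x.IsRun Δ) {p : Fin n} {t t' : ℕ} (h : t ≤ t') {v : V}
    (hv : (snapAt x t p).input = some v) : (snapAt x t' p).input = some v :=
  snapAt_induction hx (fun _ s => s.input = some v) hv
    (fun _ _ _ h => h) (fun _ _ _ h => nextInput_of_some h) h

theorem input_unique (hx : x.IsRun Δ) {p : Fin n} {t t' : ℕ} {v v' : V}
    (hv : (snapAt x t p).input = some v) (hv' : (snapAt x t' p).input = some v') : v = v' := by
  rcases le_total t t' with h | h
  · exact Option.some.inj ((input_mono hx h hv).symm.trans hv')
  · exact Option.some.inj (hv.symm.trans (input_mono hx h hv'))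

theorem fastVote_mono (hx : x.IsRun Δ) {p : Fin n} {t t' : ℕ} (h : t ≤ t') {a : Fin n × V}
    (hv : (snapAt x t p).fastVote = some a) : (snapAt x t' p).fastVote = some a :=
  snapAt_induction hx (fun _ s => s.fastVote = some a) hv
    (fun _ _ _ h => h) (fun _ _ _ h => nextFastVote_of_some h) h

theorem fast_mono (hx : x.IsRun Δ) {p : Fin n} {t t' : ℕ} (h : t ≤ t') {v : V}
    (hv : (snapAt x t p).fast = some v) : (snapAt x t' p).fast = some v :=
  snapAt_induction hx (fun _ s => s.fast = some v) hv
    (fun _ _ _ h => h) (fun _ _ _ h => nextFast_of_some h) h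

theorem ballot_ne_zero_mono {s s' : Snapshot n V} (h : s.ballot ≤ s'.ballot)
    (hs : s.ballot ≠ 0) : s'.ballot ≠ 0 := by omega

/-- Outside ballot `0`, the vote in the fast ballot is final. -/
theorem fastVote_final (hx : x.IsRun Δ) {p : Fin n} {t t' : ℕ} {a : Fin n × V}
    (hv : (snapAt x t p).fastVote = some a) (hb : (snapAt x t' p).ballot ≠ 0) :
    (snapAt x t' p).fastVote = some a := by
  rcases le_total t t' with h | h
  · exact fastVote_mono hx h hv
  · have := snapAt_induction hx
      (fun _ s => s.ballot ≠ 0 ∧ s.fastVote = (snapAt x t' p).fastVote) ⟨hb, rfl⟩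
      (fun _ _ _ h => h) (fun _ _ _ h =>
        have h1 := ballot_ne_zero_mono (s' := nextSnapshot e f p _ _ _ _) ballot_le_nextBallot h.1
        ⟨h1, (nextFastVote_of_ne_zero h1).trans h.2⟩) h
    rw [← this.2, hv]

theorem fast_final (hx : x.IsRun Δ) {p : Fin n} {t t' : ℕ} {v : V}
    (hv : (snapAt x t p).fast = some v) (hb : (snapAt x t' p).ballot ≠ 0) :
    (snapAt x t' p).fast = some v := by
  rcases le_total t t' with h | h
  · exact fast_mono hx h hv
  · have := snapAt_induction hx
      (fun _ s => s.ballot ≠ 0 ∧ s.fast = (snapAt x t' p).fast) ⟨hb, rfl⟩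
      (fun _ _ _ h => h) (fun _ _ _ h =>
        have h1 := ballot_ne_zero_mono (s' := nextSnapshot e f p _ _ _ _) ballot_le_nextBallot h.1
        ⟨h1, (nextFast_of_ne_zero h1).trans h.2⟩) h
    rw [← this.2, hv]

/-- A process only votes in the fast ballot for its own input, if it has one. -/
theorem fastVote_input (hx : x.IsRun Δ) {p : Fin n} {t t' : ℕ} {a : Fin n × V} {v : V}
    (ha : (snapAt x t p).fastVote = some a) (hv : (snapAt x t' p).input = some v) : v = a.2 := by
  have key : ∀ t, ∀ a v, (snapAt x t p).fastVote = some a → (snapAt x t p).input = some v →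
      v = a.2 := fun t => snapAt_induction hx
    (fun _ s => ∀ a v, s.fastVote = some a → s.input = some v → v = a.2) (t₀ := 0)
    (by simp [snapAt_zero hx]) (fun _ _ _ h => h) (by
      intro t _ _ h a v ha hv
      replace ha : nextFastVote _ _ _ _ = some a := ha
      replace hv : nextInput _ _ = some v := hv
      rcases nextFastVote_spec ha with h1 | ⟨h1, h2, h3, h4⟩
      · refine h a v h1 ?_
        rw [nextInput, if_neg (by simp [h1])] at hv
        exact hv
      · rw [hv] at h3
        simpa using h3) (Nat.zero_le t)
  rcases le_total t t' with h | h
  · exact key t' a v (fastVote_mono hx h ha) hv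
  · exact key t a v ha (input_mono hx h hv)

theorem fastVote_origin (hx : x.IsRun Δ) {p : Fin n} {t : ℕ} {a : Fin n × V}
    (ha : (snapAt x t p).fastVote = some a) : ∃ t', (snapAt x t' a.1).input = some a.2 :=
  snapAt_induction hx
    (fun _ s => s.fastVote = some a → ∃ t', (snapAt x t' a.1).input = some a.2) (t₀ := 0)
    (by simp [snapAt_zero hx]) (fun _ _ _ h => h) (by
      intro t _ _ h ha
      replace ha : nextFastVote _ _ _ _ = some a := ha
      rcases nextFastVote_spec ha with h1 | ⟨h1, h2, h3, m, hm, h4⟩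
      · exact h h1
      · obtain ⟨t', -, rfl⟩ := exists_of_mem_logAt hx hm
        exact ⟨t', h4⟩) (Nat.zero_le t) ha

/-- The processes that ever vote for the input `v` of `p` in the fast ballot. -/
noncomputable def fastQuorum (x : Execution (protocol n V e f Δ)) (p : Fin n) (v : V) :
    Finset (Fin n) :=
  open Classical in Finset.univ.filter fun q => q ≠ p ∧ ∃ t, (snapAt x t q).fastVote = some (p, v)

theorem mem_fastQuorum {p q : Fin n} {v : V} :
    q ∈ fastQuorum x p v ↔ q ≠ p ∧ ∃ t, (snapAt x t q).fastVote = some (p, v) := by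
  simp [fastQuorum]

/-- The summand `1` stands for the proposer, which is counted among its voters but left out of
`fastQuorum`. -/
theorem fast_origin (hx : x.IsRun Δ) {p : Fin n} {t : ℕ} {v : V}
    (hv : (snapAt x t p).fast = some v) :
    (∃ t', (snapAt x t' p).input = some v) ∧ n ≤ (fastQuorum x p v).card + 1 + e :=
  snapAt_induction hx (fun t s => s.fast = some v → (∃ t', (snapAt x t' p).input = some v) ∧
      n ≤ (fastQuorum x p v).card + 1 + e) (t₀ := 0)
    (by simp [snapAt_zero hx]) (fun _ _ _ h => h) (by
      classical
      intro t _ ha h hv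
      replace hv : nextFast _ _ _ _ _ _ = some v := hv
      rcases nextFast_spec hv with h1 | ⟨h1, h2, h3⟩
      · exact h h1
      · refine ⟨⟨t + 1, by rw [snapAt_succ hx ha]; exact h2⟩, ?_⟩
        have : fastVoters p (logAt x (t + 1) p) v ⊆ insert p (fastQuorum x p v) := by
          intro q hq
          rw [Finset.mem_insert, mem_fastQuorum]
          by_cases hqp : q = p
          · exact Or.inl hqp
          · obtain ⟨m, hm, hm'⟩ := (mem_fastVoters.1 hq).resolve_left hqp
            obtain ⟨t', -, rfl⟩ := exists_of_mem_logAt hx hm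
            exact Or.inr ⟨hqp, t', hm'⟩
        have h4 := (Finset.card_le_card this).trans (Finset.card_insert_le _ _)
        omega) (Nat.zero_le t) hv

/-- This excludes rival proposers from the fast quorum, a unit that the bound `2e + f - 1` needs. -/
theorem notMem_fastQuorum (hx : x.IsRun Δ) {p q : Fin n} {t : ℕ} {v v' : V}
    (hq : (snapAt x t q).input = some v') (hne : v' ≠ v) : q ∉ fastQuorum x p v := by
  intro h
  obtain ⟨-, t', ht'⟩ := mem_fastQuorum.1 h
  exact hne (fastVote_input hx ht' hq)

/-- Fast quorums for different values are disjoint and avoid both proposers, so `2(n - e - 1) ≤ n -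
2`, against `2e < n`. -/
theorem fast_unique (hx : x.IsRun Δ) (hen : 2 * e + 1 ≤ n) {p p' : Fin n} {t t' : ℕ} {v v' : V}
    (hv : (snapAt x t p).fast = some v) (hv' : (snapAt x t' p').fast = some v') : v = v' := by
  classical
  by_contra hne
  obtain ⟨⟨i, hi⟩, hc⟩ := fast_origin hx hv
  obtain ⟨⟨i', hi'⟩, hc'⟩ := fast_origin hx hv'
  have hpp : p ≠ p' := by
    rintro rfl
    exact hne (input_unique hx hi hi')
  have hdisj : Disjoint (fastQuorum x p v) (fastQuorum x p' v') := by
    rw [Finset.disjoint_left]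
    intro q h1 h2
    obtain ⟨-, t1, ht1⟩ := mem_fastQuorum.1 h1
    obtain ⟨-, t2, ht2⟩ := mem_fastQuorum.1 h2
    rcases le_total t1 t2 with h | h
    · have := (fastVote_mono hx h ht1).symm.trans ht2
      simp_all
    · have := (fastVote_mono hx h ht2).symm.trans ht1
      simp_all
  have hsub : fastQuorum x p v ∪ fastQuorum x p' v' ⊆ ({p, p'} : Finset (Fin n))ᶜ := by
    intro q hq
    rw [Finset.mem_compl, Finset.mem_insert, Finset.mem_singleton]
    rw [Finset.mem_union] at hq
    rintro (rfl | rfl)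
    · rcases hq with hq | hq
      · exact (mem_fastQuorum.1 hq).1 rfl
      · exact notMem_fastQuorum hx hi hne hq
    · rcases hq with hq | hq
      · exact notMem_fastQuorum hx hi' (Ne.symm hne) hq
      · exact (mem_fastQuorum.1 hq).1 rfl
  have h1 := Finset.card_le_card hsub
  rw [Finset.card_union_of_disjoint hdisj, Finset.card_compl, Finset.card_pair hpp,
    Fintype.card_fin] at h1
  omega

/-- `v` has been proposed in ballot `b`. -/
def IsProposed (x : Execution (protocol n V e f Δ)) (b : ℕ) (v : V) : Prop :=
  ∃ p t, Owns p b ∧ (snapAt x t p).ballot = b ∧ (snapAt x t p).proposal = some v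

theorem proposal_mono (hx : x.IsRun Δ) {p : Fin n} {t t' : ℕ} (h : t ≤ t') {v : V}
    (hv : (snapAt x t p).proposal = some v) (hb : (snapAt x t' p).ballot = (snapAt x t p).ballot) :
    (snapAt x t' p).proposal = some v :=
  snapAt_induction hx
    (fun _ s => s.ballot = (snapAt x t p).ballot → s.proposal = some v) (fun _ => hv)
    (fun _ _ _ h => h) (fun t'' h1 h2 h3 h4 => by
      have h5 := ballot_mono hx p h1
      replace h4 : nextBallot _ _ _ _ = _ := h4
      have h6 := ballot_le_nextBallot (p := p) (s := snapAt x t'' p)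
        (log := logAt x (t'' + 1) p) (l := leaderAt x t'' p)
      have h7 : (snapAt x t'' p).ballot = (snapAt x t p).ballot := by omega
      show nextProposal _ _ _ _ _ _ = _
      rw [nextProposal, if_pos ⟨by rw [h4, h7], by rw [h3 h7]; rfl⟩, h3 h7]) h hb

theorem Owns.unique {p q : Fin n} {b : ℕ} (hp : Owns p b) (hq : Owns q b) : p = q :=
  Fin.ext (hp.2.symm.trans hq.2)

theorem IsProposed.unique (hx : x.IsRun Δ) {b : ℕ} {v v' : V} (h : IsProposed x b v)
    (h' : IsProposed x b v') : v = v' := by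
  obtain ⟨p, t, h1, h2, h3⟩ := h
  obtain ⟨p', t', h1', h2', h3'⟩ := h'
  obtain rfl := h1.unique h1'
  rcases le_total t t' with h | h
  · exact Option.some.inj ((proposal_mono hx h h3 (h2'.trans h2.symm)).symm.trans h3')
  · exact Option.some.inj (h3.symm.trans (proposal_mono hx h h3' (h2.trans h2'.symm)))

/-- A vote in a slow ballot follows the proposal in that ballot. -/
theorem vote_origin (hx : x.IsRun Δ) {p : Fin n} {t : ℕ} {a : ℕ × V}
    (ha : (snapAt x t p).vote = some a) : ∃ q, ∃ t' < t, Owns q a.1 ∧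
      (snapAt x t' q).ballot = a.1 ∧ (snapAt x t' q).proposal = some a.2 :=
  snapAt_induction hx (fun t s => s.vote = some a → ∃ q, ∃ t' < t, Owns q a.1 ∧
      (snapAt x t' q).ballot = a.1 ∧ (snapAt x t' q).proposal = some a.2) (t₀ := 0)
    (by simp [snapAt_zero hx]) (fun t _ _ h ha => by
      obtain ⟨q, t', h1, h2⟩ := h ha
      exact ⟨q, t', by omega, h2⟩) (by
      intro t _ _ h ha
      replace ha : nextVote _ _ _ = some a := ha
      rcases nextVote_spec ha with h1 | ⟨h1, ⟨q, m⟩, hm, h2, h3, h4⟩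
      · obtain ⟨q, t', h1, h2⟩ := h h1
        exact ⟨q, t', by omega, h2⟩
      · obtain ⟨t', ht', rfl⟩ := exists_of_mem_logAt hx hm
        rw [← h1] at h2 h3
        exact ⟨q, t', ht', h2, h3, h4⟩) (Nat.zero_le t) ha

theorem vote_isProposed (hx : x.IsRun Δ) {p : Fin n} {t b : ℕ} {v : V}
    (h : (snapAt x t p).vote = some (b, v)) : IsProposed x b v := by
  obtain ⟨q, t', -, h1, h2, h3⟩ := vote_origin hx h
  exact ⟨q, t', h1, h2, h3⟩

theorem vote_ballot_le (hx : x.IsRun Δ) {p : Fin n} {t b : ℕ} {v : V}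
    (h : (snapAt x t p).vote = some (b, v)) : b ≤ (snapAt x t p).ballot :=
  snapAt_induction hx (fun t s => ∀ a, s.vote = some a → a.1 ≤ s.ballot) (t₀ := 0)
    (by simp [snapAt_zero hx]) (fun _ _ _ h => h) (by
      intro t _ _ h a ha
      replace ha : nextVote _ _ _ = some a := ha
      rcases nextVote_spec ha with h1 | ⟨h1, -⟩
      · exact (h a h1).trans ballot_le_nextBallot
      · exact h1.le) (Nat.zero_le t) _ h

theorem vote_mono (hx : x.IsRun Δ) {p : Fin n} {t t' b : ℕ} (htt : t ≤ t') {v : V}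
    (h : (snapAt x t p).vote = some (b, v)) :
    ∃ b' v', (snapAt x t' p).vote = some (b', v') ∧ b ≤ b' := by
  induction t', htt using Nat.le_induction with
  | base => exact ⟨b, v, h, le_rfl⟩
  | succ t' ht ih =>
    obtain ⟨b', v', h1, h2⟩ := ih
    by_cases ha : x.active t' p
    · rw [snapAt_succ hx ha]
      obtain ⟨b'', v'', h3, h4⟩ := nextVote_isSome (log := logAt x (t' + 1) p) h1
        ((vote_ballot_le hx h1).trans (ballot_le_nextBallot (l := leaderAt x t' p)
          (p := p) (log := logAt x (t' + 1) p)))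
      exact ⟨b'', v'', h3, h2.trans h4⟩
    · rw [snapAt, state_idle hx ha]
      exact ⟨b', v', h1, h2⟩

theorem exists_vote_in_ballot (hx : x.IsRun Δ) {p : Fin n} {t b : ℕ} {v : V}
    (h : (snapAt x t p).vote = some (b, v)) :
    ∃ t', (snapAt x t' p).ballot = b ∧ (snapAt x t' p).vote = some (b, v) :=
  snapAt_induction hx (fun t s => s.vote = some (b, v) →
      ∃ t', (snapAt x t' p).ballot = b ∧ (snapAt x t' p).vote = some (b, v)) (t₀ := 0)
    (by simp [snapAt_zero hx]) (fun _ _ _ h => h) (by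
      intro t _ ha h h'
      have h'' : nextVote _ _ _ = some (b, v) := h'
      rcases nextVote_spec h'' with h1 | ⟨h1, -⟩
      · exact h h1
      · refine ⟨t + 1, ?_, ?_⟩
        · rw [snapAt_succ hx ha]; exact h1.symm
        · rw [snapAt_succ hx ha]; exact h') (Nat.zero_le t) h

/-- A process that has joined a higher ballot than `b` has reported its vote in ballot `b`, or
one in a higher ballot. -/
theorem vote_of_ballot_lt (hx : x.IsRun Δ) {p : Fin n} {t t' b : ℕ} {v : V}
    (h : (snapAt x t p).vote = some (b, v)) (hb : b < (snapAt x t' p).ballot) :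
    ∃ b' v', (snapAt x t' p).vote = some (b', v') ∧ b ≤ b' := by
  obtain ⟨t₀, h1, h2⟩ := exists_vote_in_ballot hx h
  refine vote_mono hx ?_ h2
  by_contra hlt
  have := ballot_mono hx p (not_le.1 hlt).le
  omega

/-- The step at which a value is proposed. -/
theorem IsProposed.origin (hx : x.IsRun Δ) {b : ℕ} {v : V} (h : IsProposed x b v) :
    ∃ p t c, Owns p b ∧ (snapAt x (t + 1) p).ballot = b ∧
      ¬ (b = (snapAt x t p).ballot ∧ (snapAt x t p).proposal.isSome) ∧
      n - f ≤ (joined (logAt x (t + 1) p) b).card ∧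
      pick (logAt x (t + 1) p) b c = some v := by
  obtain ⟨p, t, h1, h2, h3⟩ := h
  refine snapAt_induction hx (fun t s => s.ballot = b → s.proposal = some v →
    ∃ p t c, Owns p b ∧ (snapAt x (t + 1) p).ballot = b ∧
      ¬ (b = (snapAt x t p).ballot ∧ (snapAt x t p).proposal.isSome) ∧
      n - f ≤ (joined (logAt x (t + 1) p) b).card ∧
      pick (logAt x (t + 1) p) b c = some v) (t₀ := 0)
    (by simp [snapAt_zero hx]) (fun _ _ _ h => h) ?_ (Nat.zero_le t) h2 h3
  intro t _ ha ih hb hv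
  have hv' : nextProposal _ _ _ _ _ _ = some v := hv
  have hb' : nextBallot _ _ _ _ = b := hb
  rcases nextProposal_spec hv' with ⟨h4, h5⟩ | ⟨h4, h5, h6, h7⟩
  · exact ih (h4.symm.trans hb') h5
  · rw [hb'] at h4 h5 h6 h7
    exact ⟨p, t, _, h5, by rw [snapAt_succ hx ha]; exact hb, h4, h6, h7⟩

end Run

end FastConsensus

/-! ### Agreement and validity -/

namespace FastConsensus

variable {n : ℕ} {V : Type u} {e f Δ : ℕ} {x : Execution (protocol n V e f Δ)}

/-- The processes that ever vote for `v` in the slow ballot `b`. -/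
noncomputable def quorum (x : Execution (protocol n V e f Δ)) (b : ℕ) (v : V) : Finset (Fin n) :=
  open Classical in Finset.univ.filter fun q => ∃ t, (snapAt x t q).vote = some (b, v)

theorem mem_quorum {b : ℕ} {v : V} {q : Fin n} :
    q ∈ quorum x b v ↔ ∃ t, (snapAt x t q).vote = some (b, v) := by
  simp [quorum]

def IsChosen (x : Execution (protocol n V e f Δ)) (b : ℕ) (v : V) : Prop :=
  n - f ≤ (quorum x b v).card

theorem exists_mem_of_card_add_card {A B : Finset (Fin n)} (h : n < A.card + B.card) :
    ∃ q ∈ A, q ∈ B := by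
  by_contra hAB
  push Not at hAB
  have := Finset.card_le_univ (A.disjUnion B (Finset.disjoint_left.2 hAB))
  rw [Finset.card_disjUnion, Fintype.card_fin] at this
  omega

theorem IsChosen.isProposed (hx : x.IsRun Δ) (hf : 2 * f + 1 ≤ n) {b : ℕ} {v : V}
    (h : IsChosen x b v) : IsProposed x b v := by
  have : (quorum x b v).Nonempty := by
    rw [← Finset.card_pos]
    unfold IsChosen at h
    omega
  obtain ⟨q, hq⟩ := this
  obtain ⟨t, ht⟩ := mem_quorum.1 hq
  exact vote_isProposed hx ht

theorem joined_report (hx : x.IsRun Δ) {p q : Fin n} {t b : ℕ}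
    (hq : q ∈ joined (logAt x t p) b) :
    ∃ t', (q, snapAt x t' q) ∈ logAt x t p ∧ (snapAt x t' q).ballot = b := by
  obtain ⟨m, hm, hb⟩ := mem_joined.1 hq
  obtain ⟨t', -, rfl⟩ := exists_of_mem_logAt hx hm
  exact ⟨t', hm, hb⟩

/-- A ballot that does not find any vote in a slow ballot, nor any report of a decision in the
fast one, proposes the value decided in the fast ballot, if there is one. -/
theorem eq_of_fast_of_isMostSupported (hx : x.IsRun Δ) (hf : 2 * f + 1 ≤ n)
    (he : 2 * e + f ≤ n + 1) (hef : e ≤ f) {p₀ : Fin n} {t₀ : ℕ} {w : V}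
    (hw : (snapAt x t₀ p₀).fast = some w) {p : Fin n} {t b : ℕ} (hb : b ≠ 0)
    (hQ : n - f ≤ (joined (logAt x t p) b).card)
    (hfast : ¬ ∃ v, ∃ m ∈ logAt x t p, m.2.fast = some v) :
    (∃ a, IsMostSupported (logAt x t p) b a) ∧
      ∀ a, IsMostSupported (logAt x t p) b a → a.2 = w := by
  classical
  obtain ⟨⟨i, hi⟩, hcard⟩ := fast_origin hx hw
  set Q := joined (logAt x t p) b
  set S := fastQuorum x p₀ w
  -- If `p₀` had joined ballot `b`, its report would show the decision, as `fast` is final outside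
  -- ballot `0`.
  have hp₀ : p₀ ∉ Q := by
    intro h
    obtain ⟨t', hm, hb'⟩ := joined_report hx h
    exact hfast ⟨w, _, hm, fast_final hx hw (by rwa [hb'])⟩
  have hsupp : S ∩ Q ⊆ supporters (logAt x t p) b (p₀, w) := by
    intro q hq
    obtain ⟨h1, h2⟩ := Finset.mem_inter.1 hq
    obtain ⟨-, t1, ht1⟩ := mem_fastQuorum.1 h1
    obtain ⟨t', hm, hb'⟩ := joined_report hx h2
    exact mem_supporters.2 ⟨_, hm, hb', fastVote_final hx ht1 (by rwa [hb'])⟩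
  have hQn : Q.card ≤ n := by simpa using Finset.card_le_univ Q
  -- Each process known to be outside `S ∪ Q` improves the lower bound on `|S ∩ Q|` by one.
  have hbound : ∀ R : Finset (Fin n), Disjoint R Q → Disjoint R S →
      S.card + Q.card + R.card ≤ n + (S ∩ Q).card := by
    intro R h1 h2
    have h3 := Finset.card_union_add_card_inter S Q
    have h4 : Disjoint R (S ∪ Q) := Finset.disjoint_union_right.2 ⟨h2, h1⟩
    have h5 := Finset.card_le_univ (R ∪ (S ∪ Q))
    rw [Finset.card_union_of_disjoint h4, Fintype.card_fin] at h5
    omega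
  have hp₀S : p₀ ∉ S := fun h => (mem_fastQuorum.1 h).1 rfl
  constructor
  -- Here `|S ∩ Q| ≥ n - e - f > 0`, so `(p₀, w)` has a supporter.
  · have := hbound {p₀} (by simpa using hp₀) (by simpa using hp₀S)
    rw [Finset.card_singleton] at this
    refine exists_isMostSupported (a := (p₀, w)) hp₀ ((Finset.card_pos.1 ?_).mono hsupp)
    omega
  · rintro ⟨q₀, v⟩ ⟨h1, ⟨q₁, hq₁⟩, h3⟩
    by_contra hne
    replace hne : v ≠ w := hne
    obtain ⟨m, hm, hmb, hmv⟩ := mem_supporters.1 hq₁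
    obtain ⟨t', -, rfl⟩ := exists_of_mem_logAt hx hm
    obtain ⟨t₁, ht₁⟩ := fastVote_origin hx hmv
    have hpq : p₀ ≠ q₀ := by
      rintro rfl
      exact hne (input_unique hx ht₁ hi)
    have hq₀S : q₀ ∉ S := notMem_fastQuorum hx ht₁ hne
    -- Two outsiders give `|S ∩ Q| ≥ |Q| - e + 1`, leaving at most `e - 1` supporters to the rival,
    -- fewer than `w` has.
    have h4 := hbound {p₀, q₀} (by simp [hp₀, show q₀ ∉ Q from h1]) (by simp [hp₀S, hq₀S])
    rw [Finset.card_pair hpq] at h4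
    have h5 : supporters (logAt x t p) b (q₀, v) ⊆ Q \ (S ∩ Q) := by
      intro q hq
      refine Finset.mem_sdiff.2 ⟨supporters_subset_joined _ _ hq, fun hqS => ?_⟩
      obtain ⟨m', hm', hb', hv'⟩ := mem_supporters.1 hq
      obtain ⟨t', -, rfl⟩ := exists_of_mem_logAt hx hm'
      obtain ⟨-, t2, ht2⟩ := mem_fastQuorum.1 (Finset.mem_inter.1 hqS).1
      have := (fastVote_final hx ht2 (by rwa [hb'])).symm.trans hv'
      simp only [Option.some.injEq, Prod.mk.injEq] at this
      exact hne this.2.symm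
    have h6 := Finset.card_le_card h5
    have h7 := Finset.card_le_card hsupp
    have h8 := h3 (p₀, w) hp₀
    rw [Finset.card_sdiff_of_subset Finset.inter_subset_right] at h6
    omega

/-- Strong induction on the ballot, examining the step at which its value was picked. Fast decisions
and choices in lower ballots are treated together, since the picked value may come from either. -/
theorem IsProposed.safe (hx : x.IsRun Δ) (hf : 2 * f + 1 ≤ n) (he : 2 * e + f ≤ n + 1)
    (hef : e ≤ f) {b : ℕ} {v : V} (h : IsProposed x b v) :
    (∀ p t w, (snapAt x t p).fast = some w → v = w) ∧
      ∀ b' w, b' < b → IsChosen x b' w → v = w := by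
  induction b using Nat.strong_induction_on generalizing v with
  | _ b ih =>
  obtain ⟨p, t, c, hown, hpb, hnew, hQ, hpick⟩ := h.origin hx
  -- A vote in ballot `b` itself would require an earlier proposal in `b` by the same owner,
  -- contrary to `hnew`.
  have hlt : ∀ q m, (q, m) ∈ logAt x (t + 1) p → m.ballot = b → ∀ a, m.vote = some a →
      a.1 < b := by
    rintro q m hm hb ⟨k, u⟩ ha
    obtain ⟨t', ht', rfl⟩ := exists_of_mem_logAt hx hm
    refine lt_of_le_of_ne (hb ▸ vote_ballot_le hx ha) ?_
    rintro rfl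
    obtain ⟨q', t'', ht'', h1, h2, h3⟩ := vote_origin hx ha
    obtain rfl := hown.unique h1
    have h4 := ballot_mono hx p (show t'' ≤ t by omega)
    have h5 := ballot_mono hx p (show t ≤ t + 1 by omega)
    dsimp only at h2 h3
    have h6 : (snapAt x t p).ballot = (snapAt x t'' p).ballot := by omega
    exact hnew ⟨by omega, by rw [proposal_mono hx (by omega) h3 h6]; rfl⟩
  -- Two sets of `n - f` processes meet as `2f < n`; a common member has joined `b` and reports a
  -- vote in `b'` or above.
  have hinter : ∀ b' w, b' < b → IsChosen x b' w → ∃ q m k u, (q, m) ∈ logAt x (t + 1) p ∧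
      m.ballot = b ∧ m.vote = some (k, u) ∧ b' ≤ k := by
    intro b' w hb' hw
    unfold IsChosen at hw
    obtain ⟨q, h1, h2⟩ := exists_mem_of_card_add_card
      (show n < (quorum x b' w).card + (joined (logAt x (t + 1) p) b).card by omega)
    obtain ⟨t1, ht1⟩ := mem_quorum.1 h1
    obtain ⟨t', hm, hb⟩ := joined_report hx h2
    obtain ⟨k, u, hk, hku⟩ := vote_of_ballot_lt hx ht1 (hb.symm ▸ hb' : b' < (snapAt x t' q).ballot)
    exact ⟨q, _, k, u, hm, hb, hk, hku⟩
  rcases pick_spec hpick with ⟨⟨q, m⟩, hm, hv⟩ | ⟨hfast, ⟨k, hk⟩ | ⟨hvote, h⟩⟩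
  · obtain ⟨t', -, rfl⟩ := exists_of_mem_logAt hx hm
    refine ⟨fun p' t' w hw => fast_unique hx (by omega) hv hw, fun b' w hb' hw => ?_⟩
    -- A value chosen in a lower ballot was proposed there, hence equals the fast decision by
    -- induction.
    exact ((ih b' hb' (hw.isProposed hx hf)).1 _ _ _ hv).symm
  · obtain ⟨⟨⟨q, m⟩, hm, hmb, hmv⟩, hmax⟩ := hk
    have hkb : k < b := hlt q m hm hmb _ hmv
    obtain ⟨t', -, rfl⟩ := exists_of_mem_logAt hx hm
    have hprop := vote_isProposed hx hmv
    refine ⟨(ih k hkb hprop).1, fun b' w hb' hw => ?_⟩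
    obtain ⟨q', m', k', u, h1, h2, h3, h4⟩ := hinter b' w hb' hw
    have h5 : k' ≤ k := hmax (q', m') h1 h2 _ h3
    -- The latest vote is from ballot `k ≥ b'`: induction applies above `b'`, and in `b'` itself the
    -- proposal is unique.
    rcases (h4.trans h5).lt_or_eq with h6 | rfl
    · exact (ih k hkb hprop).2 b' w h6 hw
    · exact hprop.unique hx (hw.isProposed hx hf)
  · refine ⟨fun p' t' w hw => ?_, fun b' w hb' hw => ?_⟩
    · obtain ⟨h1, h2⟩ := eq_of_fast_of_isMostSupported hx hf he hef hw hown.1 hQ hfast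
      rcases h with ⟨q, h⟩ | ⟨h, -⟩
      · exact h2 _ h
      · exact (h h1).elim
    · obtain ⟨q', m', k', u, h1, h2, h3, h4⟩ := hinter b' w hb' hw
      exact (hvote (exists_isLatestVote h1 h2 h3)).elim

theorem decision_origin (hx : x.IsRun Δ) {p : Fin n} {t : ℕ} {w : V}
    (h : decisionAt x t p = some w) :
    (∃ q t', (snapAt x t' q).fast = some w) ∨ ∃ b, IsChosen x b w := by
  induction t with
  | zero => rw [decisionAt, hx.start] at h; simp at h
  | succ t ih =>
    by_cases ha : x.active t p
    · rw [decisionAt_succ hx ha] at h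
      rcases nextDecision_spec h with h | h | ⟨b, h⟩
      · exact ih h
      · exact Or.inl ⟨p, t + 1, h⟩
      · refine Or.inr ⟨b, h.trans (Finset.card_le_card fun q hq => ?_)⟩
        obtain ⟨m, hm, hv⟩ := mem_voters.1 hq
        obtain ⟨t', -, rfl⟩ := exists_of_mem_logAt hx hm
        exact mem_quorum.2 ⟨t', hv⟩
    · rw [decisionAt, state_idle hx ha] at h
      exact ih h

theorem decision_unique (hx : x.IsRun Δ) (hf : 2 * f + 1 ≤ n) (he : 2 * e + f ≤ n + 1)
    (hef : e ≤ f) {p p' : Fin n} {t t' : ℕ} {w w' : V} (h : decisionAt x t p = some w)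
    (h' : decisionAt x t' p' = some w') : w = w' := by
  rcases decision_origin hx h with ⟨q, s, h1⟩ | ⟨b, h1⟩ <;>
    rcases decision_origin hx h' with ⟨q', s', h2⟩ | ⟨b', h2⟩
  · exact fast_unique hx (by omega) h1 h2
  · exact (((h2.isProposed hx hf).safe hx hf he hef).1 _ _ _ h1).symm
  · exact ((h1.isProposed hx hf).safe hx hf he hef).1 _ _ _ h2
  · have h3 := h1.isProposed hx hf
    have h4 := h2.isProposed hx hf
    rcases lt_trichotomy b b' with hb | rfl | hb
    · exact ((h4.safe hx hf he hef).2 _ _ hb h1).symm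
    · exact h3.unique hx h4
    · exact (h3.safe hx hf he hef).2 _ _ hb h2

/-- The value `w` occurs in a snapshot. -/
def Snapshot.Carries (s : Snapshot n V) (w : V) : Prop :=
  s.proposal = some w ∨ (∃ b, s.vote = some (b, w)) ∨ s.input = some w ∨
    (∃ q, s.fastVote = some (q, w)) ∨ s.fast = some w ∨ s.candidate = some w

theorem carries_nextSnapshot {p : Fin n} {s : Snapshot n V} {log : List (Fin n × Snapshot n V)}
    {l : Prop} {inv : Option V} {w : V} (h : (nextSnapshot e f p s log l inv).Carries w) :
    s.Carries w ∨ inv = some w ∨ ∃ m ∈ log, m.2.Carries w := by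
  have hinput : nextInput s inv = some w → s.Carries w ∨ inv = some w := by
    intro h
    unfold nextInput at h
    split_ifs at h with h1
    · exact Or.inr h
    · exact Or.inl (Or.inr (Or.inr (Or.inl h)))
  have hcand : nextCandidate s log inv = some w →
      s.Carries w ∨ inv = some w ∨ ∃ m ∈ log, m.2.Carries w := by
    intro h
    unfold nextCandidate at h
    rw [Option.or_eq_some_iff, Option.or_eq_some_iff] at h
    rcases h with (h | ⟨-, h⟩) | ⟨-, h⟩
    · exact Or.inl (by simp [Snapshot.Carries, h])
    · exact Or.inr (Or.inl h)
    · obtain ⟨m, hm, h⟩ := List.exists_of_findSome?_eq_some h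
      exact Or.inr (Or.inr ⟨m, hm, by simp [Snapshot.Carries, h]⟩)
  rcases h with h | ⟨b, h⟩ | h | ⟨q, h⟩ | h | h
  · rcases nextProposal_spec h with ⟨-, h⟩ | ⟨-, -, -, h⟩
    · exact Or.inl (Or.inl h)
    · rcases pick_spec h with ⟨m, hm, h⟩ | ⟨-, ⟨k, ⟨m, hm, -, h⟩, -⟩ | ⟨-, ⟨q, -, ⟨q', hq'⟩, -⟩ |
        ⟨-, h⟩⟩⟩
      · exact Or.inr (Or.inr ⟨m, hm, by simp [Snapshot.Carries, h]⟩)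
      · exact Or.inr (Or.inr ⟨m, hm, by simp [Snapshot.Carries, h]⟩)
      · obtain ⟨m, hm, -, h⟩ := mem_supporters.1 hq'
        exact Or.inr (Or.inr ⟨_, hm, by simp [Snapshot.Carries, h]⟩)
      · exact hcand h
  · rcases nextVote_spec h with h | ⟨-, m, hm, -, -, h⟩
    · exact Or.inl (by simp [Snapshot.Carries, h])
    · exact Or.inr (Or.inr ⟨m, hm, Or.inl h⟩)
  · exact (hinput h).imp_right Or.inl
  · rcases nextFastVote_spec h with h | ⟨-, -, -, m, hm, h⟩
    · exact Or.inl (by simp [Snapshot.Carries, h])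
    · exact Or.inr (Or.inr ⟨_, hm, by simp [Snapshot.Carries, h]⟩)
  · rcases nextFast_spec h with h | ⟨-, h, -⟩
    · exact Or.inl (by simp [Snapshot.Carries, h])
    · exact (hinput h).imp_right Or.inl
  · exact hcand h

/-- Values are only copied from strictly earlier snapshots or taken from a call, so induction on
time leads back to a call. -/
theorem Snapshot.Carries.exists_invoke (hx : x.IsRun Δ) {t : ℕ} :
    ∀ {p : Fin n} {w : V}, (snapAt x t p).Carries w → ∃ i < t, ∃ q, x.invoke i q = some w := by
  induction t using Nat.strong_induction_on with
  | _ t ih =>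
  intro p w h
  cases t with
  | zero => simp [snapAt_zero hx, Snapshot.Carries] at h
  | succ t =>
    by_cases ha : x.active t p
    · rw [snapAt_succ hx ha] at h
      rcases carries_nextSnapshot h with h | h | ⟨m, hm, h⟩
      · obtain ⟨i, hi, h⟩ := ih t (by omega) h
        exact ⟨i, by omega, h⟩
      · exact ⟨t, by omega, p, h⟩
      · obtain ⟨t', ht', h'⟩ := exists_of_mem_logAt hx hm
        rw [h'] at h
        obtain ⟨i, hi, h⟩ := ih t' ht' h
        exact ⟨i, by omega, h⟩
    · rw [snapAt, state_idle hx ha] at h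
      obtain ⟨i, hi, h⟩ := ih t (by omega) h
      exact ⟨i, by omega, h⟩

theorem decision_valid (hx : x.IsRun Δ) (hf : 2 * f + 1 ≤ n) {p : Fin n} {t : ℕ} {w : V}
    (h : decisionAt x t p = some w) : ∃ i < t, ∃ q, x.invoke i q = some w := by
  induction t with
  | zero => rw [decisionAt, hx.start] at h; simp at h
  | succ t ih =>
    by_cases ha : x.active t p
    · rw [decisionAt_succ hx ha] at h
      rcases nextDecision_spec h with h | h | ⟨b, h⟩
      · obtain ⟨i, hi, h⟩ := ih h
        exact ⟨i, by omega, h⟩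
      · exact Snapshot.Carries.exists_invoke hx (p := p) (by simp [Snapshot.Carries, h])
      · obtain ⟨q, hq⟩ := Finset.card_pos.1 (show 0 < (voters (logAt x (t + 1) p) b w).card by omega)
        obtain ⟨m, hm, hv⟩ := mem_voters.1 hq
        obtain ⟨t', ht', rfl⟩ := exists_of_mem_logAt hx hm
        obtain ⟨i, hi, h⟩ := Snapshot.Carries.exists_invoke hx
          (show (snapAt x t' q).Carries w by simp [Snapshot.Carries, hv])
        exact ⟨i, by omega, h⟩
    · rw [decisionAt, state_idle hx ha] at h
      obtain ⟨i, hi, h⟩ := ih h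
      exact ⟨i, by omega, h⟩

/-! ### Calls and returns of the protocol -/

theorem decision_of_output (hx : x.IsRun Δ) {p : Fin n} {t : ℕ} {w : V}
    (h : x.output t p = some w) : x.active t p ∧ decisionAt x (t + 1) p = some w ∧
      (LocalState.pending (x.state t p) ∨ (x.invoke t p).isSome) := by
  have ha : x.active t p := by
    by_contra ha
    simp [(hx.idle t p ha).2.2.1] at h
  rw [output_eq hx ha] at h
  split_ifs at h with h1
  exact ⟨ha, h, h1⟩

theorem pending_succ (hx : x.IsRun Δ) {p : Fin n} {t : ℕ} :
    LocalState.pending (x.state (t + 1) p) ↔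
      (LocalState.pending (x.state t p) ∨ (x.invoke t p).isSome) ∧ x.output t p = none := by
  by_cases ha : x.active t p
  · rw [output_eq hx ha, decisionAt, state_succ hx ha]
    show (_ ∧ _) ↔ _
    split_ifs with h
    · rfl
    · simp [h]
  · rw [state_idle hx ha]
    have := hx.idle t p ha
    simp [this.2.2.1, this.2.2.2.1]

theorem pending_iff (hx : x.IsRun Δ) {p : Fin n} {t : ℕ} :
    LocalState.pending (x.state t p) ↔
      ∃ i < t, (x.invoke i p).isSome ∧ ∀ s, i ≤ s → s < t → x.output s p = none := by
  induction t with
  | zero => rw [hx.start]; simp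
  | succ t ih =>
    rw [pending_succ hx, ih]
    constructor
    · rintro ⟨⟨i, h1, h2, h3⟩ | h1, h4⟩
      · refine ⟨i, by omega, h2, fun s hs hs' => ?_⟩
        rcases Nat.lt_succ_iff_lt_or_eq.1 hs' with h | rfl
        · exact h3 s hs h
        · exact h4
      · refine ⟨t, by omega, h1, fun s hs hs' => ?_⟩
        obtain rfl : s = t := by omega
        exact h4
    · rintro ⟨i, h1, h2, h3⟩
      refine ⟨?_, h3 t (by omega) (by omega)⟩
      rcases Nat.lt_succ_iff_lt_or_eq.1 h1 with h | rfl
      · exact Or.inl ⟨i, h, h2, fun s hs hs' => h3 s hs (by omega)⟩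
      · exact Or.inr h2

theorem wellFormed (hx : x.IsRun Δ) : x.WellFormed := by
  intro t p w h
  rcases (decision_of_output hx h).2.2 with h1 | h1
  · obtain ⟨i, h2, h3, h4⟩ := (pending_iff hx).1 h1
    exact ⟨i, h3, h2.le, h, h4⟩
  · exact ⟨t, h1, le_rfl, h, fun s _ _ => by omega⟩

theorem linearizable (hx : x.IsRun Δ) (hf : 2 * f + 1 ≤ n) (he : 2 * e + f ≤ n + 1)
    (hef : e ≤ f) : x.Linearizable := by
  refine Execution.linearizable_of_agreement (wellFormed hx) ?_ ?_
  · intro t t' p p' w w' h h'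
    exact decision_unique hx hf he hef (decision_of_output hx h).2.1
      (decision_of_output hx h').2.1
  · intro t p w h
    obtain ⟨i, hi, h⟩ := decision_valid hx hf (decision_of_output hx h).2.1
    exact ⟨i, by omega, h⟩

/-- A call returns once there is a decision. -/
theorem exists_output (hx : x.IsRun Δ) {p : Fin n} {i t : ℕ} (hi : (x.invoke i p).isSome)
    (hit : i ≤ t) (ha : x.active t p) (hd : decisionAt x (t + 1) p ≠ none) :
    ∃ t' ≤ t, ∃ w, x.Returns p i t' w := by
  have : ∃ t', i ≤ t' ∧ t' ≤ t ∧ x.output t' p ≠ none := by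
    by_contra hno
    push Not at hno
    have hpend : LocalState.pending (x.state t p) ∨ (x.invoke t p).isSome := by
      rcases hit.lt_or_eq with h | rfl
      · exact Or.inl ((pending_iff hx).2 ⟨i, h, hi, fun s hs hs' => hno s hs hs'.le⟩)
      · exact Or.inr hi
    have := hno t hit le_rfl
    rw [output_eq hx ha, if_pos hpend] at this
    exact hd this
  classical
  obtain ⟨h1, h2, h3⟩ := Nat.find_spec this
  obtain ⟨w, hw⟩ := Option.ne_none_iff_exists'.1 h3
  refine ⟨_, h2, w, hi, h1, hw, fun s hs hs' => ?_⟩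
  by_contra h
  exact Nat.find_min this hs' ⟨hs, by omega, h⟩

end FastConsensus

/-! #### Liveness -/

namespace FastConsensus

open Filter

variable {n : ℕ} {V : Type u} {e f Δ : ℕ}

section Next

variable {p : Fin n} {s : Snapshot n V} {log : List (Fin n × Snapshot n V)}

theorem pick_ne_none {b : ℕ} {c : Option V} (hc : c ≠ none) : pick log b c ≠ none := by
  unfold pick
  split_ifs
  all_goals first | exact Option.some_ne_none _ | exact hc

theorem nextProposal_ne_none {b : ℕ} {c : Option V} (hown : Owns p b)
    (hj : n - f ≤ (joined log b).card) (hc : c ≠ none) : nextProposal f p s log b c ≠ none := by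
  unfold nextProposal
  split_ifs with h1 h2
  · exact Option.isSome_iff_ne_none.1 h1.2
  · exact pick_ne_none hc
  · exact (h2 ⟨hown, hj⟩).elim

theorem nextCandidate_ne_none {inv : Option V}
    (h : s.candidate ≠ none ∨ inv ≠ none ∨ ∃ m ∈ log, m.2.candidate ≠ none) :
    nextCandidate s log inv ≠ none := by
  unfold nextCandidate
  intro h'
  simp only [Option.or_eq_none_iff, List.findSome?_eq_none_iff] at h'
  rcases h with h | h | ⟨m, hm, h⟩
  · exact h h'.1.1
  · exact h h'.1.2
  · exact h (h'.2 m hm)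

theorem nextVote_of_proposed {b : ℕ} {v : V} (h : Proposed log b v) :
    ∃ v', nextVote s log b = some (b, v') := by
  unfold nextVote
  rw [dif_pos ⟨v, h⟩]
  exact ⟨_, rfl⟩

theorem nextDecision_ne_none {d c : Option V}
    (h : d ≠ none ∨ c ≠ none ∨ ∃ b v, n - f ≤ (voters log b v).card) :
    nextDecision f log d c ≠ none := by
  unfold nextDecision
  intro h'
  simp only [Option.or_eq_none_iff] at h'
  rcases h with h | h | ⟨b, v, h⟩
  · exact h h'.1
  · exact h h'.2.1
  · rw [dif_pos ⟨v, b, h⟩] at h'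
    simp at h'

end Next

variable {x : Execution (protocol n V e f Δ)}

theorem eventually_active {G : ℕ} (hG : x.TimelyFrom Δ G) {p : Fin n} (hp : x.Correct p) {t : ℕ}
    (ht : G ≤ t) : x.active t p :=
  hG.1 t p ht (by rw [show x.crashAt p = ⊤ from hp]; exact WithTop.coe_lt_top _)

theorem mem_logAt_of_timely (hx : x.IsRun Δ) {G : ℕ} (hG : x.TimelyFrom Δ G) {p q : Fin n}
    (hp : x.Correct p) (hq : x.Correct q) {t : ℕ} (ht : G ≤ t) :
    ∃ t' ≤ t + Δ, t < t' ∧ (p, t) ∈ x.inbox t' q := by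
  have ha := eventually_active hG hp ht
  obtain ⟨t', h1, h2⟩ := hG.2 t p q (by rw [sent_eq hx ha]; rfl)
    (by rw [show x.crashAt p = ⊤ from hp]; exact WithTop.coe_lt_top _)
    (by rw [show x.crashAt q = ⊤ from hq]; exact WithTop.coe_lt_top _)
  rw [max_eq_left ht] at h1
  exact ⟨t', h1, (hx.no_creation _ _ _ _ h2).1, h2⟩

theorem active_of_mem_inbox (hx : x.IsRun Δ) {t : ℕ} {q : Fin n} {m : Fin n × ℕ}
    (h : m ∈ x.inbox t q) : x.active t q := by
  by_contra ha
  simp [(hx.idle t q ha).2.2.2.2] at h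

/-- What holds eventually of the snapshots of a correct process is eventually known to each
correct process. -/
theorem eventually_mem_logAt (hx : x.IsRun Δ) {p q : Fin n} (hp : x.Correct p)
    (hq : x.Correct q) {Q : Snapshot n V → Prop} (hQ : ∀ᶠ t in atTop, Q (snapAt x t p)) :
    ∀ᶠ t in atTop, ∃ m, (p, m) ∈ logAt x t q ∧ Q m := by
  obtain ⟨G, hG⟩ := hx.partially_synchronous
  obtain ⟨T, hT⟩ := eventually_atTop.1 hQ
  obtain ⟨t', h1, h2, h3⟩ := mem_logAt_of_timely hx hG hp hq (le_max_left G T)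
  refine eventually_atTop.2 ⟨t' + 1, fun t ht => ⟨snapAt x (max G T + 1) p, ?_, ?_⟩⟩
  · refine logAt_mono hx ht q _ ?_
    rw [logAt_succ hx (active_of_mem_inbox hx h3)]
    exact List.mem_append_right _ ((mem_received hx).2 ⟨_, h3, rfl⟩)
  · exact hT _ ((le_max_right G T).trans (Nat.le_succ _))

theorem eventually_succ {Q : ℕ → Prop} (h : ∀ᶠ t in atTop, Q (t + 1)) : ∀ᶠ t in atTop, Q t := by
  obtain ⟨T, hT⟩ := eventually_atTop.1 h
  refine eventually_atTop.2 ⟨T + 1, fun t ht => ?_⟩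
  obtain ⟨t, rfl⟩ := Nat.exists_eq_succ_of_ne_zero (show t ≠ 0 by omega)
  exact hT t (by omega)

theorem eventually_of_step (hx : x.IsRun Δ) {p : Fin n} (hp : x.Correct p)
    {Q : ℕ → Prop} (h : ∀ᶠ t in atTop, x.active t p → Q (t + 1)) : ∀ᶠ t in atTop, Q t := by
  obtain ⟨G, hG⟩ := hx.partially_synchronous
  refine eventually_succ ?_
  filter_upwards [h, eventually_ge_atTop G] with t ht hGt
  exact ht (eventually_active hG hp hGt)

theorem exists_crash {p : Fin n} (hp : ¬ x.Correct p) (hx : x.IsRun Δ) :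
    ∃ c : ℕ, ∀ t, x.active t p → t < c := by
  obtain ⟨c, hc⟩ := ENat.ne_top_iff_exists.1 hp
  refine ⟨c, fun t ht => ?_⟩
  have := hx.crash t p ht
  rw [← hc] at this
  exact_mod_cast this

/-- A faulty process sends finitely many messages, and each is delivered at most once. -/
theorem eventually_not_mem_inbox (hx : x.IsRun Δ) {p : Fin n} (hp : ¬ x.Correct p) (q : Fin n) :
    ∀ᶠ t in atTop, ∀ m ∈ x.inbox t q, m.1 ≠ p := by
  obtain ⟨c, hc⟩ := exists_crash hp hx
  have h1 : ∀ τ, ∀ᶠ t in atTop, (p, τ) ∉ x.inbox t q := by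
    intro τ
    by_cases h : ∃ t, (p, τ) ∈ x.inbox t q
    · obtain ⟨t₀, ht₀⟩ := h
      filter_upwards [eventually_gt_atTop t₀] with t ht h
      exact ht.ne (hx.no_duplication _ _ _ _ ht₀ h)
    · push Not at h
      exact Eventually.of_forall h
  have h2 : ∀ᶠ t in atTop, ∀ τ ∈ Finset.range c, (p, τ) ∉ x.inbox t q :=
    (Finset.eventually_all _).2 fun τ _ => h1 τ
  filter_upwards [h2] with t ht
  rintro ⟨s, τ⟩ hm rfl
  exact ht τ (Finset.mem_range.2 (hc τ (active_of_sent hx (hx.no_creation _ _ _ _ hm).2))) hm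

/-! ### Clocks and leader election -/

abbrev clockAt (x : Execution (protocol n V e f Δ)) (t : ℕ) (p : Fin n) : ℕ :=
  LocalState.clock (x.state t p)

abbrev heardAt (x : Execution (protocol n V e f Δ)) (t : ℕ) (p q : Fin n) : ℕ :=
  LocalState.heard (x.state t p) q

theorem clockAt_succ (hx : x.IsRun Δ) {t : ℕ} {p : Fin n} (h : x.active t p) :
    clockAt x (t + 1) p = clockAt x t p + 1 := by
  rw [clockAt, state_succ hx h]
  rfl

open Classical in
theorem heardAt_succ (hx : x.IsRun Δ) {t : ℕ} {p : Fin n} (h : x.active t p) (q : Fin n) :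
    heardAt x (t + 1) p q = if ∃ m ∈ x.inbox t p, m.1 = q then clockAt x t p
      else heardAt x t p q := by
  have : (∃ m ∈ x.received t p, m.1 = q) ↔ ∃ m ∈ x.inbox t p, m.1 = q := by
    constructor
    · rintro ⟨⟨s, m⟩, hm, rfl⟩
      obtain ⟨τ, hτ, -⟩ := (mem_received hx).1 hm
      exact ⟨_, hτ, rfl⟩
    · rintro ⟨⟨s, τ⟩, hm, rfl⟩
      exact ⟨_, (mem_received hx).2 ⟨τ, hm, rfl⟩, rfl⟩
  rw [heardAt, state_succ hx h]
  show nextHeard _ _ _ = _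
  unfold nextHeard
  simp only [this]

theorem leaderAt_iff (hx : x.IsRun Δ) {t : ℕ} {p : Fin n} (h : x.active t p) :
    leaderAt x t p ↔ 2 * Δ < clockAt x t p ∧ ∀ q < p, heardAt x (t + 1) p q + Δ < clockAt x t p := by
  simp only [heardAt, state_succ hx h]
  rfl

theorem clockAt_add (hx : x.IsRun Δ) {T : ℕ} {p : Fin n} (h : ∀ t ≥ T, x.active t p) {t t' : ℕ}
    (ht : T ≤ t) (htt : t ≤ t') : clockAt x t' p = clockAt x t p + (t' - t) := by
  induction t', htt using Nat.le_induction with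
  | base => simp
  | succ t' htt ih => rw [clockAt_succ hx (h t' (by omega)), ih]; omega

theorem eventually_lt_clockAt (hx : x.IsRun Δ) {p : Fin n} (hp : x.Correct p) (k : ℕ) :
    ∀ᶠ t in atTop, k < clockAt x t p := by
  obtain ⟨G, hG⟩ := hx.partially_synchronous
  filter_upwards [eventually_ge_atTop (G + k + 1)] with t ht
  rw [clockAt_add hx (fun t ht => eventually_active hG hp ht) le_rfl (show G ≤ t by omega)]
  omega

/-- The entry of a faulty process is eventually frozen, while the clock keeps advancing. -/
theorem eventually_heardAt_lt (hx : x.IsRun Δ) {p q : Fin n} (hp : x.Correct p)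
    (hq : ¬ x.Correct q) : ∀ᶠ t in atTop, heardAt x (t + 1) p q + Δ < clockAt x t p := by
  obtain ⟨G, hG⟩ := hx.partially_synchronous
  obtain ⟨T, hT⟩ := eventually_atTop.1 (eventually_not_mem_inbox hx hq p)
  have hconst : ∀ t ≥ max G T, heardAt x t p q = heardAt x (max G T) p q := by
    intro t ht
    induction t, ht using Nat.le_induction with
    | base => rfl
    | succ t ht ih =>
      rw [heardAt_succ hx (eventually_active hG hp ((le_max_left _ _).trans ht)), if_neg, ih]
      rintro ⟨m, hm, h⟩
      exact hT t ((le_max_right _ _).trans ht) m hm h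
  filter_upwards [eventually_ge_atTop (max G T),
    eventually_lt_clockAt hx hp (heardAt x (max G T) p q + Δ)] with t h1 h2
  rwa [hconst (t + 1) (by omega)]

theorem heardAt_le_clockAt (hx : x.IsRun Δ) (t : ℕ) (p q : Fin n) :
    heardAt x t p q ≤ clockAt x t p := by
  induction t with
  | zero => rw [heardAt, hx.start]; exact Nat.zero_le _
  | succ t ih =>
    by_cases ha : x.active t p
    · rw [heardAt_succ hx ha, clockAt_succ hx ha]
      split_ifs <;> omega
    · rw [heardAt, clockAt, state_idle hx ha]
      exact ih

theorem heardAt_mono (hx : x.IsRun Δ) {t t' : ℕ} (h : t ≤ t') (p q : Fin n) :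
    heardAt x t p q ≤ heardAt x t' p q := by
  induction t', h using Nat.le_induction with
  | base => rfl
  | succ t' _ ih =>
    refine ih.trans ?_
    by_cases ha : x.active t' p
    · rw [heardAt_succ hx ha]
      split_ifs
      · exact heardAt_le_clockAt hx t' p q
      · exact le_rfl
    · rw [heardAt, heardAt, state_idle hx ha]

theorem eventually_le_heardAt (hx : x.IsRun Δ) {p q : Fin n} (hp : x.Correct p)
    (hq : x.Correct q) : ∀ᶠ t in atTop, clockAt x t p ≤ heardAt x (t + 1) p q + Δ := by
  obtain ⟨G, hG⟩ := hx.partially_synchronous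
  filter_upwards [eventually_ge_atTop (G + Δ)] with t ht
  -- The message sent at `t - Δ` arrives in `(t - Δ, t]`, so the last contact is at most `Δ` old.
  obtain ⟨t₁, h1, h2, h3⟩ := mem_logAt_of_timely hx hG hq hp (show G ≤ t - Δ by omega)
  have h4 := heardAt_succ hx (active_of_mem_inbox hx h3) q
  rw [if_pos ⟨_, h3, rfl⟩] at h4
  have h5 := heardAt_mono hx (show t₁ + 1 ≤ t + 1 by omega) p q
  rw [clockAt_add hx (fun t ht => eventually_active hG hp ht) (show G ≤ t₁ by omega)
    (show t₁ ≤ t by omega)]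
  omega

/-- The correct process of least index is eventually the only leader. -/
theorem exists_eventual_leader (hx : x.IsRun Δ) (hcorrect : ∃ p, x.Correct p) :
    ∃ l, x.Correct l ∧ ∀ᶠ t in atTop, x.active t l ∧ leaderAt x t l ∧
      ∀ p, p ≠ l → x.active t p → ¬ leaderAt x t p := by
  classical
  obtain ⟨l, hl, hmin⟩ := (Set.toFinite {p | x.Correct p}).exists_minimalFor id _ hcorrect
  replace hl : x.Correct l := hl
  have hlt : ∀ p < l, ¬ x.Correct p := fun p hp h => absurd (hmin (j := p) h hp.le) (not_le.2 hp)
  obtain ⟨G, hG⟩ := hx.partially_synchronous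
  have h1 : ∀ᶠ t in atTop, ∀ p, p < l → heardAt x (t + 1) l p + Δ < clockAt x t l :=
    eventually_all.2 fun p => by
      by_cases h : p < l
      · exact (eventually_heardAt_lt hx hl (hlt p h)).mono fun _ h _ => h
      · exact Eventually.of_forall fun _ h' => (h h').elim
  have h2 : ∀ᶠ t in atTop, ∀ p, p ≠ l → x.active t p → ¬ leaderAt x t p :=
    eventually_all.2 fun p => by
      by_cases hp : x.Correct p
      · filter_upwards [eventually_le_heardAt hx hp hl] with t ht hpl ha hlead
        have hlp : l < p := lt_of_le_of_ne (not_lt.1 fun h => hlt p h hp) hpl.symm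
        exact absurd (((leaderAt_iff hx ha).1 hlead).2 l hlp) (not_lt.2 ht)
      · obtain ⟨c, hc⟩ := exists_crash hp hx
        filter_upwards [eventually_ge_atTop c] with t ht _ ha
        exact absurd (hc t ha) (not_lt.2 ht)
  refine ⟨l, hl, ?_⟩
  filter_upwards [h1, h2, eventually_lt_clockAt hx hl (2 * Δ), eventually_ge_atTop G]
    with t h1 h2 h3 h4
  have ha := eventually_active hG hl h4
  exact ⟨ha, (leaderAt_iff hx ha).2 ⟨h3, h1⟩, h2⟩

theorem exists_eventually_eq_of_monotone {g : ℕ → ℕ} (hg : Monotone g) {K : ℕ}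
    (hK : ∀ t, g t ≤ K) : ∃ b, ∀ᶠ t in atTop, g t = b := by
  have hfin : (Set.range g).Finite :=
    (Set.finite_Iic K).subset (by rintro _ ⟨t, rfl⟩; exact hK t)
  obtain ⟨b, ⟨T, rfl⟩, hmax⟩ := hfin.exists_maximalFor id _ ⟨_, 0, rfl⟩
  refine ⟨g T, eventually_atTop.2 ⟨T, fun t ht => ?_⟩⟩
  exact le_antisymm (hmax (j := g t) ⟨t, rfl⟩ (hg ht)) (hg ht)

/-! ### Stabilization of the ballots and termination -/

theorem ballot_le_of_mem_logAt (hx : x.IsRun Δ) {t : ℕ} {p : Fin n} (ha : x.active t p)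
    {m : Fin n × Snapshot n V} (hm : m ∈ logAt x (t + 1) p) :
    m.2.ballot ≤ (snapAt x (t + 1) p).ballot := by
  rw [snapAt_succ hx ha]
  exact (ballot_le_maxBallot hm).trans maxBallot_le_nextBallot

/-- The ballot of an eventual unique leader stabilizes. -/
theorem exists_eventual_ballot_leader (hx : x.IsRun Δ) {l : Fin n}
    (hlead : ∀ᶠ t in atTop, x.active t l ∧ leaderAt x t l ∧
      ∀ p, p ≠ l → x.active t p → ¬ leaderAt x t p) :
    ∃ b, Owns l b ∧ ∀ᶠ t in atTop, (snapAt x t l).ballot = b := by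
  obtain ⟨T, hT⟩ := eventually_atTop.1 hlead
  obtain ⟨M, hM⟩ : ∃ M, ∀ p, (snapAt x T p).ballot ≤ M :=
    ⟨_, fun p => Finset.le_sup (f := fun p => (snapAt x T p).ballot) (Finset.mem_univ p)⟩
  -- After `T` only `l` starts ballots; the others merely adopt known ones.
  have hle : ∀ t ≥ T, ∀ p, (snapAt x t p).ballot ≤ max M (snapAt x t l).ballot := by
    intro t ht
    induction t, ht using Nat.le_induction with
    | base => exact fun p => (hM p).trans (le_max_left _ _)
    | succ t ht ih =>
      intro p
      have hmono : max M (snapAt x t l).ballot ≤ max M (snapAt x (t + 1) l).ballot :=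
        max_le_max_left _ (ballot_mono hx l (Nat.le_succ t))
      by_cases hpl : p = l
      · subst hpl; exact le_max_right _ _
      by_cases ha : x.active t p
      · refine le_trans ?_ hmono
        rw [snapAt_succ hx ha]
        show nextBallot _ _ _ _ ≤ _
        rw [nextBallot_eq ((hT t ht).2.2 p hpl ha)]
        refine maxBallot_le (ih p) ?_
        rintro ⟨q, m⟩ hm
        obtain ⟨t', ht', rfl⟩ := exists_of_mem_logAt hx hm
        exact (ballot_mono hx q (Nat.lt_succ_iff.1 ht')).trans (ih q)
      · rw [snapAt, state_idle hx ha]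
        exact (ih p).trans hmono
  have howns : ∀ t ≥ T, Owns l (snapAt x (t + 1) l).ballot := by
    intro t ht
    rw [snapAt_succ hx (hT t ht).1]
    exact nextBallot_owns (hT t ht).2.1
  -- Once the ballot of `l` reaches `M` after `T`, it dominates all others and is owned by `l`, so
  -- it stays put. Otherwise it remains below `M`.
  have hbdd : ∃ K, ∀ t, (snapAt x t l).ballot ≤ K := by
    by_cases h : ∃ t, T < t ∧ M ≤ (snapAt x t l).ballot
    · obtain ⟨t₁, h1, h2⟩ := h
      refine ⟨(snapAt x t₁ l).ballot, fun t => ?_⟩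
      rcases le_total t t₁ with h3 | h3
      · exact ballot_mono hx l h3
      · induction t, h3 using Nat.le_induction with
        | base => exact le_rfl
        | succ t ht ih =>
          have heq : (snapAt x t l).ballot = (snapAt x t₁ l).ballot :=
            le_antisymm ih (ballot_mono hx l ht)
          have hmax : maxBallot (snapAt x t l) (logAt x (t + 1) l) = (snapAt x t l).ballot := by
            refine le_antisymm (maxBallot_le le_rfl ?_) le_maxBallot
            rintro ⟨q, m⟩ hm
            obtain ⟨t', ht', rfl⟩ := exists_of_mem_logAt hx hm
            refine (ballot_mono hx q (Nat.lt_succ_iff.1 ht')).trans ((hle t (by omega) q).trans ?_)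
            rw [max_eq_right (by omega)]
          have hown : Owns l (snapAt x t l).ballot := by
            obtain ⟨t, rfl⟩ := Nat.exists_eq_succ_of_ne_zero (show t ≠ 0 by omega)
            exact howns t (by omega)
          rw [snapAt_succ hx (hT t (by omega)).1]
          show nextBallot _ _ _ _ ≤ _
          rw [nextBallot, if_neg (by rw [hmax]; exact fun h => h.2 hown), hmax, heq]
    · push Not at h
      refine ⟨max M (snapAt x T l).ballot, fun t => ?_⟩
      rcases le_or_gt t T with h3 | h3
      · exact (ballot_mono hx l h3).trans (le_max_right _ _)
      · exact (h t h3).le.trans (le_max_left _ _)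
  obtain ⟨K, hK⟩ := hbdd
  obtain ⟨b, hb⟩ := exists_eventually_eq_of_monotone
    (g := fun t => (snapAt x t l).ballot) (fun t t' h => ballot_mono hx l h) hK
  refine ⟨b, ?_, hb⟩
  obtain ⟨T', hT'⟩ := eventually_atTop.1 hb
  have := howns (max T T') (le_max_left _ _)
  rwa [hT' _ ((le_max_right T T').trans (Nat.le_succ _))] at this

/-- A higher ballot at `p` would reach `l` and raise its ballot beyond `b`; conversely `p` hears of
`b` from `l`. -/
theorem eventually_ballot_eq (hx : x.IsRun Δ) {l p : Fin n} {b : ℕ} (hl : x.Correct l)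
    (hp : x.Correct p) (hb : ∀ᶠ t in atTop, (snapAt x t l).ballot = b) :
    ∀ᶠ t in atTop, (snapAt x t p).ballot = b := by
  have hle : ∀ t, (snapAt x t p).ballot ≤ b := by
    intro t
    by_contra hlt
    have h1 : ∀ᶠ t in atTop, b < (snapAt x t p).ballot := by
      filter_upwards [eventually_ge_atTop t] with t' ht'
      exact (not_le.1 hlt).trans_le (ballot_mono hx p ht')
    have h2 : ∀ᶠ t in atTop, b < (snapAt x t l).ballot := by
      refine eventually_of_step hx hl ?_
      filter_upwards [(tendsto_add_atTop_nat 1).eventually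
        (eventually_mem_logAt hx hp hl (Q := fun m => b < m.ballot) h1)] with t ⟨m, hm, hbm⟩ ha
      exact hbm.trans_le (ballot_le_of_mem_logAt hx ha hm)
    obtain ⟨t', h3, h4⟩ := (hb.and h2).exists
    omega
  refine eventually_of_step hx hp ?_
  filter_upwards [(tendsto_add_atTop_nat 1).eventually
    (eventually_mem_logAt hx hl hp (Q := fun m => m.ballot = b) hb)] with t ⟨m, hm, hbm⟩ ha
  exact le_antisymm (hle _) (hbm ▸ ballot_le_of_mem_logAt hx ha hm)

theorem eventually_candidate (hx : x.IsRun Δ) {p : Fin n} {i : ℕ}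
    (hi : (x.invoke i p).isSome) : ∀ᶠ t in atTop, (snapAt x t p).candidate ≠ none := by
  have ha : x.active i p := by
    by_contra ha
    simp [(hx.idle i p ha).2.2.2.1] at hi
  filter_upwards [eventually_ge_atTop (i + 1)] with t ht
  refine snapAt_induction hx (fun _ s => s.candidate ≠ none) ?_ (fun _ _ _ h => h)
    (fun _ _ _ h => nextCandidate_ne_none (Or.inl h)) ht
  rw [snapAt_succ hx ha]
  exact nextCandidate_ne_none (Or.inr (Or.inl (Option.isSome_iff_ne_none.1 hi)))

/-- In the final ballot all correct processes, at least `n - f`, report to the leader. It also knows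
the candidate of the caller, so it proposes; all correct processes then vote alike. -/
theorem eventually_decision (hx : x.IsRun Δ)
    (hcard : {p | ¬ x.Correct p}.ncard ≤ f) {p : Fin n} (hp : x.Correct p) {i : ℕ}
    (hi : (x.invoke i p).isSome) : ∀ᶠ t in atTop, decisionAt x t p ≠ none := by
  classical
  have hle : ∀ S : Finset (Fin n), (∀ q, x.Correct q → q ∈ S) → n - f ≤ S.card := by
    intro S hS
    have h1 : Sᶜ.card ≤ f := by
      refine le_trans ?_ hcard
      rw [← Set.ncard_coe_finset]
      exact Set.ncard_le_ncard (fun q hq h => Finset.mem_compl.1 hq (hS q h)) (Set.toFinite _)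
    rw [Finset.card_compl, Fintype.card_fin] at h1
    omega
  obtain ⟨l, hl, hlead⟩ := exists_eventual_leader hx ⟨p, hp⟩
  obtain ⟨b, hown, hb⟩ := exists_eventual_ballot_leader hx hlead
  have hlogs : ∀ (q : Fin n), x.Correct q → ∀ Q : Snapshot n V → Prop,
      (∀ r, x.Correct r → ∀ᶠ t in atTop, Q (snapAt x t r)) →
      ∀ᶠ t in atTop, ∀ r, x.Correct r → ∃ m, (r, m) ∈ logAt x (t + 1) q ∧ Q m := by
    intro q hq Q hQ
    refine eventually_all.2 fun r => ?_
    by_cases hr : x.Correct r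
    · filter_upwards [(tendsto_add_atTop_nat 1).eventually
        (eventually_mem_logAt hx hr hq (hQ r hr))] with t ht _ using ht
    · exact Eventually.of_forall fun _ h => (hr h).elim
  have hball : ∀ r, x.Correct r → ∀ᶠ t in atTop, (snapAt x t r).ballot = b :=
    fun r hr => eventually_ballot_eq hx hl hr hb
  have hprop : ∃ v, ∀ᶠ t in atTop, (snapAt x t l).ballot = b ∧
      (snapAt x t l).proposal = some v := by
    have h1 : ∀ᶠ t in atTop, (snapAt x t l).proposal ≠ none := by
      refine eventually_of_step hx hl ?_
      filter_upwards [hlogs l hl (fun m => m.ballot = b) hball,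
        (tendsto_add_atTop_nat 1).eventually hb, (tendsto_add_atTop_nat 1).eventually
        (eventually_mem_logAt hx hp hl (Q := fun m => m.candidate ≠ none)
          (eventually_candidate hx hi))] with t h1 h2 ⟨m, hm, hc⟩ ha
      rw [snapAt_succ hx ha] at h2 ⊢
      replace h2 : nextBallot _ _ _ _ = b := h2
      show nextProposal _ _ _ _ _ _ ≠ none
      rw [h2]
      exact nextProposal_ne_none hown (hle _ fun q hq => mem_joined.2 (h1 q hq))
        (nextCandidate_ne_none (Or.inr (Or.inr ⟨_, hm, hc⟩)))
    obtain ⟨T, hT⟩ := eventually_atTop.1 (h1.and hb)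
    obtain ⟨v, hv⟩ := Option.ne_none_iff_exists'.1 (hT T le_rfl).1
    refine ⟨v, eventually_atTop.2 ⟨T, fun t ht => ⟨(hT t ht).2, ?_⟩⟩⟩
    exact proposal_mono hx ht hv ((hT t ht).2.trans (hT T le_rfl).2.symm)
  obtain ⟨v, hv⟩ := hprop
  have hprop' : IsProposed x b v := by
    obtain ⟨t, ht⟩ := hv.exists
    exact ⟨l, t, hown, ht⟩
  have hvote : ∀ r, x.Correct r → ∀ᶠ t in atTop, (snapAt x t r).vote = some (b, v) := by
    intro r hr
    refine eventually_of_step hx hr ?_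
    filter_upwards [(tendsto_add_atTop_nat 1).eventually (eventually_mem_logAt hx hl hr
      (Q := fun m => m.ballot = b ∧ m.proposal = some v) hv),
      (tendsto_add_atTop_nat 1).eventually (hball r hr)] with t ⟨m, hm, hmb, hmv⟩ h2 ha
    rw [snapAt_succ hx ha] at h2
    replace h2 : nextBallot _ _ _ _ = b := h2
    obtain ⟨v', hv'⟩ := nextVote_of_proposed (s := snapAt x t r)
      (show Proposed (logAt x (t + 1) r) b v from ⟨_, hm, hown, hmb, hmv⟩)
    have h3 : (snapAt x (t + 1) r).vote = some (b, v') := by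
      rw [snapAt_succ hx ha]
      show nextVote _ _ (nextBallot _ _ _ _) = _
      rw [h2, hv']
    -- The vote takes an arbitrary known proposal of the ballot, which is unique.
    rw [h3, (vote_isProposed hx h3).unique hx hprop']
  refine eventually_of_step hx hp ?_
  filter_upwards [hlogs p hp (fun m => m.vote = some (b, v)) hvote] with t h1 ha
  rw [decisionAt_succ hx ha]
  exact nextDecision_ne_none (Or.inr (Or.inr ⟨b, v, hle _ fun q hq => mem_voters.2 (h1 q hq)⟩))

theorem waitFree (hx : x.IsRun Δ) (hcard : {p | ¬ x.Correct p}.ncard ≤ f) : x.WaitFree := by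
  intro p i hp hi
  obtain ⟨G, hG⟩ := hx.partially_synchronous
  obtain ⟨t, ht, h1, h2⟩ := ((tendsto_add_atTop_nat 1).eventually
    (eventually_decision hx hcard hp hi)).and
    ((eventually_ge_atTop i).and (eventually_ge_atTop G)) |>.exists
  obtain ⟨t', -, h⟩ := exists_output hx hi h1 (eventually_active hG hp h2) ht
  exact ⟨t', h⟩

theorem protocol_resilient (hf : 2 * f + 1 ≤ n) (he : 2 * e + f ≤ n + 1) (hef : e ≤ f) :
    (protocol n V e f Δ).Resilient Δ f :=
  fun _ hx hcard => ⟨linearizable hx hf he hef, waitFree hx hcard⟩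

end FastConsensus

/-! #### Synchronous runs -/

open Classical in
/-- The synchronous schedule in which the processes in `E` crash at the beginning, each `q` calls
`propose (val q)` at time `0` if `val q` is a value, and the messages from `p` are delivered
first. -/
noncomputable def synchronousSchedule {n : ℕ} {V : Type u} (Δ : ℕ) (E : Finset (Fin n))
    (val : Fin n → Option V) (p : Fin n) : Schedule n V where
  crashAt q := if q ∈ E then 0 else ⊤
  active _ q := q ∉ E
  invoke t q := if t = 0 then val q else none
  deliver t _ :=
    ((messagesBefore n t).filter fun m => m.1 = p ∧ t = (m.2 / Δ + 1) * Δ) ++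
      (messagesBefore n t).filter fun m => m.1 ≠ p ∧ t = (m.2 / Δ + 1) * Δ

section Synchronous

variable {n : ℕ} {V : Type u} {Δ : ℕ} {E : Finset (Fin n)} {val : Fin n → Option V} {p : Fin n}

theorem mem_synchronousSchedule_deliver {t : ℕ} {q : Fin n} {m : Fin n × ℕ} :
    m ∈ (synchronousSchedule Δ E val p).deliver t q ↔ m.2 < t ∧ t = (m.2 / Δ + 1) * Δ := by
  simp only [synchronousSchedule, List.mem_append, List.mem_filter, mem_messagesBefore,
    decide_eq_true_eq]
  tauto

theorem synchronousSchedule_mem_inbox (P : Protocol n V) (hΔ : 0 < Δ) {τ : ℕ} {s q : Fin n}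
    (hq : q ∉ E) (hs : (((synchronousSchedule Δ E val p).run P).sent τ s q).isSome) :
    (s, τ) ∈ ((synchronousSchedule Δ E val p).run P).inbox ((τ / Δ + 1) * Δ) q := by
  have h : τ < (τ / Δ + 1) * Δ := by
    rw [mul_comm]
    exact Nat.lt_mul_div_succ τ hΔ
  exact (Schedule.mem_run_inbox _ _).2 ⟨hq, mem_synchronousSchedule_deliver.2 ⟨h, rfl⟩, h, hs⟩

theorem synchronousSchedule_isRun (P : Protocol n V) (hΔ : 0 < Δ) :
    ((synchronousSchedule Δ E val p).run P).IsRun Δ := by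
  apply Schedule.run_isRun
  · intro t q hq
    simp only [synchronousSchedule] at hq ⊢
    simp [hq]
  · intro t q
    refine List.Nodup.append ((nodup_messagesBefore n t).filter _)
      ((nodup_messagesBefore n t).filter _) fun m h h' => ?_
    simp only [List.mem_filter, decide_eq_true_eq] at h h'
    exact h'.2.1 h.2.1
  · intro t t' q m h h'
    exact (mem_synchronousSchedule_deliver.1 h).2.trans (mem_synchronousSchedule_deliver.1 h').2.symm
  · intro q i j hi hj
    simp only [synchronousSchedule] at hi hj
    split_ifs at hi hj <;> simp_all
  · refine ⟨0, ?_, ?_⟩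
    · intro t q _ hq h
      simp [Schedule.run, synchronousSchedule, h] at hq
    · intro τ s q hs _ hq
      have hqE : q ∉ E := by
        intro h
        simp [Schedule.run, synchronousSchedule, h] at hq
      refine ⟨_, ?_, synchronousSchedule_mem_inbox P hΔ hqE hs⟩
      have := Nat.div_mul_le_self τ Δ
      rw [add_mul, one_mul]
      omega

theorem synchronousSchedule_faultySynchronous (P : Protocol n V) (hΔ : 0 < Δ) :
    ((synchronousSchedule Δ E val p).run P).FaultySynchronous Δ E where
  faulty _ hq := if_pos hq
  correct _ hq := if_neg hq
  instantaneous _ _ hq := hq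
  delivery _ _ _ hq hs := synchronousSchedule_mem_inbox P hΔ hq hs

theorem synchronousSchedule_invoke (P : Protocol n V) (t : ℕ) (q : Fin n) (hq : q ∉ E) :
    ((synchronousSchedule Δ E val p).run P).invoke t q = if t = 0 then val q else none :=
  if_pos (c := (synchronousSchedule Δ E val p).active t q) hq

theorem synchronousSchedule_invoke_of_mem (P : Protocol n V) (t : ℕ) (q : Fin n) (hq : q ∈ E) :
    ((synchronousSchedule Δ E val p).run P).invoke t q = none :=
  if_neg (c := (synchronousSchedule Δ E val p).active t q) fun h => h hq

/-- The first message delivered at the end of a round is from `p`. -/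
theorem synchronousSchedule_inbox_head (P : Protocol n V) {t : ℕ} {q : Fin n}
    (h : ∃ τ, (p, τ) ∈ ((synchronousSchedule Δ E val p).run P).inbox t q) :
    ∃ τ l, ((synchronousSchedule Δ E val p).run P).inbox t q = (p, τ) :: l := by
  classical
  obtain ⟨τ, hτ⟩ := h
  have hq : (synchronousSchedule Δ E val p).active t q := ((Schedule.mem_run_inbox _ _).1 hτ).1
  rw [Schedule.run_inbox, if_pos hq] at hτ ⊢
  simp only [synchronousSchedule, List.filter_append, List.mem_append] at hτ ⊢
  set A := ((messagesBefore n t).filter fun m => m.1 = p ∧ t = (m.2 / Δ + 1) * Δ).filter _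
  have hA : ∀ m ∈ A, m.1 = p := by
    intro m hm
    have := List.mem_of_mem_filter hm
    simp only [List.mem_filter, decide_eq_true_eq] at this
    exact this.2.1
  have hτA : (p, τ) ∈ A := by
    refine hτ.resolve_right fun h => ?_
    have := List.mem_of_mem_filter h
    simp at this
  match hAe : A, hA, hτA with
  | (s, τ') :: l, hA, _ =>
    obtain rfl : s = p := hA _ List.mem_cons_self
    exact ⟨τ', _, rfl⟩

end Synchronous

namespace FastConsensus

variable {n : ℕ} {V : Type u} {e f Δ : ℕ} {x : Execution (protocol n V e f Δ)}

/-! ### Two-step runs of the protocol -/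

theorem clockAt_le (hx : x.IsRun Δ) (t : ℕ) (p : Fin n) : clockAt x t p ≤ t := by
  induction t with
  | zero => rw [clockAt, hx.start]
  | succ t ih =>
    by_cases ha : x.active t p
    · rw [clockAt_succ hx ha]; omega
    · rw [clockAt, state_idle hx ha]; exact Nat.le_succ_of_le ih

/-- No slow ballot is started by time `2Δ`. -/
theorem ballot_eq_zero (hx : x.IsRun Δ) {t : ℕ} (ht : t ≤ 2 * Δ + 1) (p : Fin n) :
    (snapAt x t p).ballot = 0 := by
  induction t using Nat.strong_induction_on generalizing p with
  | _ t ih =>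
  cases t with
  | zero => rw [snapAt_zero hx]
  | succ t =>
    by_cases ha : x.active t p
    · have hlead : ¬ leaderAt x t p := fun h => by
        have := ((leaderAt_iff hx ha).1 h).1
        have := clockAt_le hx t p
        omega
      rw [snapAt_succ hx ha]
      show nextBallot _ _ _ _ = 0
      rw [nextBallot_eq hlead, ← Nat.le_zero]
      refine maxBallot_le (ih t (by omega) (by omega) p).le ?_
      rintro ⟨q, m⟩ hm
      obtain ⟨t', ht', rfl⟩ := exists_of_mem_logAt hx hm
      exact (ih t' ht' (by omega) q).le
    · rw [snapAt, state_idle hx ha]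
      exact ih t (by omega) (by omega) p

theorem input_eq (hx : x.IsRun Δ) {v : V} (hv : ∀ t q w, x.invoke t q = some w → w = v)
    (t : ℕ) (q : Fin n) : (snapAt x t q).input = none ∨ (snapAt x t q).input = some v :=
  snapAt_induction hx (fun _ s => s.input = none ∨ s.input = some v) (t₀ := 0)
    (by simp [snapAt_zero hx]) (fun _ _ _ h => h) (fun t _ _ h => by
      show nextInput _ _ = _ ∨ nextInput _ _ = _
      unfold nextInput
      split_ifs
      · cases hw : x.invoke t q with
        | none => exact Or.inl rfl
        | some w => exact Or.inr (congrArg some (hv _ _ _ hw))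
      · exact h) (Nat.zero_le t)

/-- The case `t = Δ` is included because `logAt x Δ` precedes the deliveries at time `Δ`. -/
theorem logAt_eq_nil (hx : x.IsRun Δ) {E : Finset (Fin n)} (hE : x.FaultySynchronous Δ E) {t : ℕ}
    (ht : t ≤ Δ) (q : Fin n) : logAt x t q = [] := by
  induction t with
  | zero => rw [logAt, hx.start]
  | succ t ih =>
    by_cases ha : x.active t q
    · have hin : x.inbox t q = [] := by
        rw [List.eq_nil_iff_forall_not_mem]
        rintro ⟨s, τ⟩ hm
        have h1 := (hE.of_mem_inbox hx hm).2.2.1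
        have : 1 * Δ ≤ (τ / Δ + 1) * Δ := Nat.mul_le_mul_right _ (Nat.le_add_left 1 _)
        omega
      rw [logAt_succ hx ha, ih (by omega), Execution.received, hin]
      rfl
    · rw [logAt, state_idle hx ha]
      exact ih (by omega)

theorem fastVote_eq_none (hx : x.IsRun Δ) {E : Finset (Fin n)} (hE : x.FaultySynchronous Δ E)
    {t : ℕ} (ht : t ≤ Δ) (q : Fin n) : (snapAt x t q).fastVote = none := by
  refine snapAt_induction hx (fun t s => t ≤ Δ → s.fastVote = none) (t₀ := 0)
    (by simp [snapAt_zero hx]) (fun t _ _ h ht => h (by omega)) ?_ (Nat.zero_le t) ht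
  intro t _ _ h ht
  show nextFastVote _ _ _ _ = none
  rw [logAt_eq_nil hx hE ht]
  unfold nextFastVote
  split_ifs
  · rfl
  · exact h (by omega)

/-- At time `Δ` everybody hears of `p` first and votes for it, since no differing input exists. At
`2Δ` these `n - e` votes reach `p`, still in ballot `0`. -/
theorem twoStepFor_of_synchronous (hx : x.IsRun Δ) (hΔ : 0 < Δ) {E : Finset (Fin n)}
    (hE : x.FaultySynchronous Δ E) (hcard : E.card = e) {p : Fin n} (hp : p ∉ E) {v : V}
    (hpv : x.invoke 0 p = some v) (hv : ∀ t q w, x.invoke t q = some w → w = v)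
    (hhead : ∀ q, (∃ τ, (p, τ) ∈ x.inbox Δ q) → ∃ τ l, x.inbox Δ q = (p, τ) :: l) :
    x.TwoStepFor Δ p := by
  have hact := hE.instantaneous
  have hinput : ∀ t, (snapAt x (t + 1) p).input = some v := by
    intro t
    refine input_mono hx (Nat.le_add_left 1 t) ?_
    rw [snapAt_succ hx (hact 0 p hp), snapAt_zero hx, hpv]
    rfl
  have hsent : ∀ τ s q, s ∉ E → q ∉ E → (s, τ) ∈ x.inbox ((τ / Δ + 1) * Δ) q :=
    fun τ s q hs hq => hE.delivery τ s q hq (by rw [sent_eq hx (hact τ s hs)]; rfl)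
  -- Index `Δ + 1` denotes the snapshot after the step at time `Δ`, which is the one sent at that
  -- time.
  have hvote : ∀ q ∉ E, (snapAt x (Δ + 1) q).fastVote = some (p, v) := by
    intro q hq
    obtain ⟨τ, l, hl⟩ := hhead q ⟨0, by simpa using hsent 0 p q hp hq⟩
    have hlog : ∃ l', logAt x (Δ + 1) q = (p, snapAt x (τ + 1) p) :: l' := by
      rw [logAt_succ hx (hact Δ q hq), logAt_eq_nil hx hE le_rfl, List.nil_append,
        Execution.received, hl]
      refine ⟨_, List.filterMap_cons_some ?_⟩
      rw [sent_eq hx (hact τ p hp)]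
      rfl
    obtain ⟨l', hl'⟩ := hlog
    have hb := ballot_eq_zero hx (show Δ + 1 ≤ 2 * Δ + 1 by omega) q
    have hi := input_eq hx hv (Δ + 1) q
    rw [snapAt_succ hx (hact Δ q hq)] at hb hi ⊢
    replace hb : nextBallot _ _ _ _ = 0 := hb
    replace hi : nextInput _ _ = none ∨ nextInput _ _ = some v := hi
    show nextFastVote _ _ (nextBallot _ _ _ _) _ = _
    rw [nextFastVote, if_pos ⟨fastVote_eq_none hx hE le_rfl q, hb⟩, hl', List.findSome?_cons]
    simp only [hinput τ, Option.filter_some]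
    -- The vote is compatible because the input of `q` is absent or equal to `v`.
    rw [if_pos (by simpa using hi)]
    rfl
  have hfast : (snapAt x (2 * Δ + 1) p).fast ≠ none := by
    have hb := ballot_eq_zero hx (show 2 * Δ + 1 ≤ 2 * Δ + 1 by omega) p
    have hi := hinput (2 * Δ)
    have hvoters : n - e ≤ (fastVoters p (logAt x (2 * Δ + 1) p) v).card := by
      have hsub : Eᶜ ⊆ fastVoters p (logAt x (2 * Δ + 1) p) v := by
        intro q hq
        rw [Finset.mem_compl] at hq
        refine mem_fastVoters.2 (Or.inr ⟨snapAt x (Δ + 1) q, ?_, hvote q hq⟩)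
        rw [logAt_succ hx (hact _ p hp)]
        refine List.mem_append_right _ ((mem_received hx).2 ⟨Δ, ?_, rfl⟩)
        have := hsent Δ q p hq hp
        rwa [Nat.div_self hΔ] at this
      have := Finset.card_le_card hsub
      rwa [Finset.card_compl, Fintype.card_fin, hcard] at this
    rw [snapAt_succ hx (hact _ p hp)] at hb hi ⊢
    replace hb : nextBallot _ _ _ _ = 0 := hb
    replace hi : nextInput _ _ = some v := hi
    show nextFast _ _ _ _ _ _ ≠ none
    unfold nextFast
    split_ifs with h
    · rw [hi, Option.filter_some, if_pos (by simpa using hvoters)]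
      exact Option.some_ne_none v
    · intro h'
      exact h ⟨h', hb⟩
  obtain ⟨t, ht, w, hw⟩ := exists_output hx (i := 0) (by rw [hpv]; rfl) (Nat.zero_le (2 * Δ))
    (hact _ p hp) (by
      rw [decisionAt_succ hx (hact _ p hp)]
      exact nextDecision_ne_none (Or.inr (Or.inl hfast)))
  exact ⟨t, w, ht, hw.2.2.1⟩

theorem protocol_twoStep (hΔ : 0 < Δ) : (protocol n V e f Δ).TwoStep Δ e := by
  classical
  intro E hE v p hp
  have key : ∀ val : Fin n → Option V, val p = some v → (∀ q w, val q = some w → w = v) →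
      ((synchronousSchedule Δ E val p).run (protocol n V e f Δ)).TwoStepFor Δ p := by
    intro val h1 h2
    refine twoStepFor_of_synchronous (synchronousSchedule_isRun _ hΔ) hΔ
      (synchronousSchedule_faultySynchronous _ hΔ) hE hp (v := v) ?_ ?_
      fun q => synchronousSchedule_inbox_head _
    · rw [synchronousSchedule_invoke _ _ _ hp, if_pos rfl, h1]
    · intro t q w hw
      by_cases hq : q ∈ E
      · simp [synchronousSchedule_invoke_of_mem _ _ _ hq] at hw
      · rw [synchronousSchedule_invoke _ _ _ hq] at hw
        split_ifs at hw
        exact h2 q w hw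
  constructor
  · refine ⟨_, synchronousSchedule_isRun _ hΔ, synchronousSchedule_faultySynchronous _ hΔ,
      ⟨0, ?_, ?_⟩, key (fun q => if q = p then some v else none) (if_pos rfl) ?_⟩
    · rw [synchronousSchedule_invoke _ _ _ hp, if_pos rfl, if_pos rfl]
    · intro t q hne
      by_cases hq : q ∈ E
      · exact synchronousSchedule_invoke_of_mem _ _ _ hq
      · rw [synchronousSchedule_invoke _ _ _ hq]
        split_ifs with h1 h2
        · exact (hne (by rw [h1, h2])).elim
        · rfl
        · rfl
    · intro q w h
      split_ifs at h
      exact (Option.some.inj h).symm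
  · refine ⟨_, synchronousSchedule_isRun _ hΔ, synchronousSchedule_faultySynchronous _ hΔ,
      ⟨?_, ?_⟩, key (fun _ => some v) rfl fun _ _ h => (Option.some.inj h).symm⟩
    · intro q hq
      rw [synchronousSchedule_invoke _ _ _ hq, if_pos rfl]
    · intro t q h
      by_cases hq : q ∈ E
      · exact synchronousSchedule_invoke_of_mem _ _ _ hq
      · rw [synchronousSchedule_invoke _ _ _ hq, if_neg (h.resolve_right hq)]

end FastConsensus

/-! ### The equivalence -/

theorem theorem2 {V : Type u} [Nontrivial V] (n e f Δ : ℕ) (hn : 3 ≤ n) (hef : e ≤ f)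
    (hΔ : 0 < Δ) :
    (∃ P : Protocol n V, P.Resilient Δ f ∧ P.TwoStep Δ e) ↔
      max (2 * e + f - 1) (2 * f + 1) ≤ n := by
  constructor
  · rintro ⟨P, hP, hT⟩
    have hf := hP.two_mul_add_one_le hn hΔ
    exact max_le (hP.le_of_twoStep hef hΔ hT hf) hf
  · intro h
    obtain ⟨h1, h2⟩ := max_le_iff.1 h
    exact ⟨FastConsensus.protocol n V e f Δ, FastConsensus.protocol_resilient h2 (by omega) hef,
      FastConsensus.protocol_twoStep hΔ⟩
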